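/- Let $k$ be an algebraically closed field of characteristic $0$ and let $\mathcal A$ be a tensor category over $k$: a small abelian $k$-linear category with a symmetric monoidal structure whose tensor product is $k$-bilinear and exact in each variable, such that $\operatorname{End}(\mathbf 1)=k$ and every object $X$ has a dual $X^\vee$, with morphisms $\mathbf 1\to X\otimes X^\vee$ and $X^\vee\otimes X\to\mathbf 1$ satisfying the triangle identities. Extend $\otimes$ to the category $\operatorname{Ind}(\mathcal A)$ of ind-objects so that it commutes with filtered colimits. An *algebra* is a nonzero commutative monoid in $\operatorname{Ind}(\mathcal A)$. For an algebra $A$, the $A$-modules in $\operatorname{Ind}(\mathcal A)$ form a symmetric monoidal category under $\otimes_A$ with unit $A$, where $M\otimes_A N$ is the coequalizer of the two action morphisms $M\otimes A\otimes N\rightrightarrows M\otimes N$; an $A$-module is *rigid* if it has a dual in this category. For an $A$-module $M$ and $n\ge 0$, let $\operatorname{Sym}^n_A(M)$ be the image of $\sum_{g\in S_n} g$ acting on $M^{\otimes_A n}$ (so $\operatorname{Sym}^0_A(M)=A$). An $A$-algebra is an algebra $B$ with a homomorphism $A\to B$; write $M_B=M\otimes_A B$ for the extension of scalars and $\mathbf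 1_B$ for $B$ as a $B$-module. Let $A$ be an algebra in $\operatorname{Ind}(\mathcal A)$ and $M$ a rigid $A$-module. Then there exists an $A$-algebra $B$ such that $\mathbf 1_B$ is a direct summand of the $B$-module $M_B$ if and only if $\operatorname{Sym}^n_A(M)\neq 0$ for all $n\ge 0$. -/

import Mathlib

open CategoryTheory MonoidalCategory Limits Opposite

universe v u w

set_option linter.unusedSectionVars false

namespace DeligneTensor

section IndTensor

open scoped ExternalProduct Prod

section
variable {K : Type u} [SmallCategory K] [MonoidalCategory K]

/-- The internal hom of presheaves for the convolution product: `y ↦ Hom (F, G (- ⊗ y))`. -/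
def dayHom (F G : K ⥤ Type u) : K ⥤ Type u :=
  (curriedTensor K).flip ⋙ ((Functor.whiskeringRight K K (Type u)).obj G) ⋙ coyoneda.obj (op F)

lemma dayNat {F H G : K ⥤ Type u} (α : F ⊠ H ⟶ tensor K ⋙ G) {x x' y y' : K} (a : x ⟶ x')
    (b : y ⟶ y') (f : F.obj x) (h : H.obj y) :
    α.app (x', y') (F.map a f, H.map b h) = G.map (a ⊗ₘ b) (α.app (x, y) (f, h)) :=
  congrArg (fun t => t (f, h)) (α.naturality (X := (x, y)) (Y := (x', y')) (Prod.mkHom a b))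

/-- Currying: maps `F x × H y ⟶ G (x ⊗ y)` natural in `x` and `y` are maps `H ⟶ dayHom F G`. -/
def dayCurry (F H G : K ⥤ Type u) :
    (F ⊠ H ⟶ tensor K ⋙ G) ≃ (H ⟶ dayHom F G) where
  toFun α :=
    { app := fun y => TypeCat.ofHom fun h =>
        { app := fun x => TypeCat.ofHom fun f => α.app (x, y) (f, h)
          naturality := fun x x' a => by
            ext f
            simpa using dayNat α a (𝟙 y) f h }
      naturality := fun y y' b => by
        ext h
        apply NatTrans.ext
        funext x
        ext f
        have := dayNat α (𝟙 x) b f h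
        rw [show F.map (𝟙 x) f = f by simp, id_tensorHom] at this
        exact this }
  invFun β :=
    { app := fun p => TypeCat.ofHom fun q =>
        (show F ⟶ tensorRight p.2 ⋙ G from β.app p.2 q.2).app p.1 q.1
      naturality := fun p p' a => by
        ext ⟨f, h⟩
        have h1 := congrArg (fun t => t h) (β.naturality a.2)
        have h2 : ∀ x, (show F ⟶ tensorRight p'.2 ⋙ G from β.app p'.2 (H.map a.2 h)).app x =
            (show F ⟶ tensorRight p.2 ⋙ G from β.app p.2 h).app x ≫ G.map (x ◁ a.2) :=
          fun x => congrArg (fun t : F ⟶ tensorRight p'.2 ⋙ G => t.app x) h1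
        have h3 := congrArg (fun t => t f)
          ((show F ⟶ tensorRight p.2 ⋙ G from β.app p.2 h).naturality a.1)
        have h4 := congrArg (fun t => t (F.map a.1 f)) (h2 p'.1)
        refine h4.trans ((congrArg (G.map (p'.1 ◁ a.2)) h3).trans ?_)
        change (G.map (a.1 ▷ p.2) ≫ G.map (p'.1 ◁ a.2)) _ = G.map (a.1 ⊗ₘ a.2) _
        rw [← G.map_comp, ← MonoidalCategory.tensorHom_def]
        rfl }
  left_inv α := rfl
  right_inv β := rfl

lemma dayCurry_naturality (F : K ⥤ Type u) {H H' G : K ⥤ Type u} (t : H' ⟶ H)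
    (α : F ⊠ H ⟶ tensor K ⋙ G) :
    dayCurry F H' G ((externalProductBifunctor K K (Type u)).map (𝟙 F ×ₘ t) ≫ α) =
      t ≫ dayCurry F H G α := by
  apply NatTrans.ext
  funext y
  ext h
  rfl

/-- In a full monoidal subcategory `D` of presheaves with the convolution product, tensoring with
`X` has a right adjoint if `D` contains the internal homs out of `X`. -/
lemma isLeftAdjoint_tensorLeft {D : Type*} [Category D] [MonoidalCategory D]
    [LawfulDayConvolutionMonoidalCategoryStruct K (Type u) D]
    [(LawfulDayConvolutionMonoidalCategoryStruct.ι K (Type u) D).Full] (X : D)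
    (h : ∀ Y : D, (LawfulDayConvolutionMonoidalCategoryStruct.ι K (Type u) D).essImage
      (dayHom ((LawfulDayConvolutionMonoidalCategoryStruct.ι K (Type u) D).obj X)
        ((LawfulDayConvolutionMonoidalCategoryStruct.ι K (Type u) D).obj Y))) :
    (tensorLeft X).IsLeftAdjoint := by
  let ι := LawfulDayConvolutionMonoidalCategoryStruct.ι K (Type u) D
  let ff : ι.FullyFaithful := .ofFullyFaithful _
  let _ := LawfulDayConvolutionMonoidalCategoryStruct.convolution K (Type u) D
  let e : ∀ Z Y : D, (X ⊗ Z ⟶ Y) ≃ (Z ⟶ (h Y).witness) := fun Z Y =>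
    ff.homEquiv.trans <|
      ((DayConvolution.corepresentableBy (ι.obj X) (ι.obj Z)).homEquiv (Y := ι.obj Y)).trans <|
      (dayCurry _ _ _).trans <| (((Iso.refl (ι.obj Z)).homCongr (h Y).getIso.symm)).trans
        ff.homEquiv.symm
  refine ⟨_, ⟨Adjunction.adjunctionOfEquivRight (F := tensorLeft X) e ?_⟩⟩
  intro Z' Z Y f g
  have key : (DayConvolution.corepresentableBy (ι.obj X) (ι.obj Z')).homEquiv (Y := ι.obj Y)
      (ι.map (X ◁ f ≫ g)) = (externalProductBifunctor K K (Type u)).map (𝟙 _ ×ₘ ι.map f) ≫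
        (DayConvolution.corepresentableBy (ι.obj X) (ι.obj Z)).homEquiv (Y := ι.obj Y)
          (ι.map g) := by
    apply NatTrans.ext
    funext p
    have := LawfulDayConvolutionMonoidalCategoryStruct.convolutionExtensionUnit_comp_ι_map_whiskerLeft_app
      (C := K) (Type u) X f p.1 p.2
    rw [Functor.map_comp]
    refine (DayConvolution.corepresentableBy_homEquiv_apply_app ..).trans
      (Eq.trans ?_ (congrArg (fun t => ((externalProductBifunctor K K (Type u)).map
        (𝟙 (ι.obj X) ×ₘ ι.map f)).app p ≫ t)
          (DayConvolution.corepresentableBy_homEquiv_apply_app ..)).symm)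
    rw [NatTrans.comp_app]
    refine (reassoc_of% this) _ |>.trans ?_
    congr 1
  apply ff.map_injective
  simp only [e, Equiv.trans_apply, Functor.FullyFaithful.homEquiv_apply]
  erw [key, dayCurry_naturality]
  simp
end

section

open LawfulDayConvolutionMonoidalCategoryStruct
attribute [local instance] convolution convolution₂ convolution₂'

variable (K : Type u) [SmallCategory K] [MonoidalCategory K] (D : Type*) [Category D]
  [MonoidalCategory D] [LawfulDayConvolutionMonoidalCategoryStruct K (Type u) D]

lemma map_whiskerLeft_eq (X : D) {Y Z : D} (f : Y ⟶ Z) :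
    (ι K (Type u) D).map (X ◁ f) =
      DayConvolution.map (𝟙 ((ι K (Type u) D).obj X)) ((ι K (Type u) D).map f) := by
  rw [← id_tensorHom, ι_map_tensorHom_hom_eq_tensorHom, CategoryTheory.Functor.map_id]

lemma map_whiskerRight_eq {Y Z : D} (f : Y ⟶ Z) (X : D) :
    (ι K (Type u) D).map (f ▷ X) =
      DayConvolution.map ((ι K (Type u) D).map f) (𝟙 ((ι K (Type u) D).obj X)) := by
  rw [← tensorHom_id, ι_map_tensorHom_hom_eq_tensorHom, CategoryTheory.Functor.map_id]

variable [SymmetricCategory K] [(ι K (Type u) D).Full]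

variable {D} in
/-- The braiding of the convolution product on a full monoidal subcategory of presheaves. -/
noncomputable def dayBraiding (X Y : D) : X ⊗ Y ≅ Y ⊗ X :=
  (Functor.FullyFaithful.ofFullyFaithful (ι K (Type u) D)).preimageIso
    (DayConvolution.braiding ((ι K (Type u) D).obj X) ((ι K (Type u) D).obj Y))

lemma map_dayBraiding (X Y : D) : (ι K (Type u) D).map (dayBraiding K X Y).hom =
    (DayConvolution.braiding ((ι K (Type u) D).obj X) ((ι K (Type u) D).obj Y)).hom := by
  simp [dayBraiding]

lemma map_associator_inv (X Y Z : D) : (ι K (Type u) D).map (α_ X Y Z).inv =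
    (DayConvolution.associator ((ι K (Type u) D).obj X) ((ι K (Type u) D).obj Y)
      ((ι K (Type u) D).obj Z)).inv := by
  rw [← cancel_epi (DayConvolution.associator ((ι K (Type u) D).obj X) ((ι K (Type u) D).obj Y)
      ((ι K (Type u) D).obj Z)).hom, Iso.hom_inv_id, ← ι_map_associator_hom_eq_associator_hom,
      ← CategoryTheory.Functor.map_comp, Iso.hom_inv_id, CategoryTheory.Functor.map_id]
  rfl

/-- The convolution product on a full monoidal subcategory of presheaves is symmetric. -/
@[reducible]
noncomputable def daySymmetric : SymmetricCategory D where
  braiding := dayBraiding K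
  braiding_naturality_left f Z := by
    apply (ι K (Type u) D).map_injective
    simp only [Functor.map_comp, map_whiskerLeft_eq, map_whiskerRight_eq, map_dayBraiding]
    exact DayConvolution.braiding_naturality_left _ _
  braiding_naturality_right X Y Z f := by
    apply (ι K (Type u) D).map_injective
    simp only [Functor.map_comp, map_whiskerLeft_eq, map_whiskerRight_eq, map_dayBraiding]
    exact DayConvolution.braiding_naturality_right _ _
  hexagon_forward X Y Z := by
    apply (ι K (Type u) D).map_injective
    simp only [Functor.map_comp, map_whiskerLeft_eq, map_whiskerRight_eq, map_dayBraiding,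
      ι_map_associator_hom_eq_associator_hom]
    exact DayConvolution.hexagon_forward ((ι K (Type u) D).obj X) ((ι K (Type u) D).obj Y)
      ((ι K (Type u) D).obj Z)
  hexagon_reverse X Y Z := by
    apply (ι K (Type u) D).map_injective
    simp only [Functor.map_comp, map_whiskerLeft_eq, map_whiskerRight_eq, map_dayBraiding,
      map_associator_inv]
    exact DayConvolution.hexagon_reverse ((ι K (Type u) D).obj X) ((ι K (Type u) D).obj Y)
      ((ι K (Type u) D).obj Z)
  symmetry X Y := by
    apply (ι K (Type u) D).map_injective
    simp only [Functor.map_comp, map_dayBraiding, CategoryTheory.Functor.map_id]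
    exact DayConvolution.symmetry _ _

end

section
variable {C : Type u} [SmallCategory C] [MonoidalCategory C]


/-- Presheaves on `C` with the convolution product. -/
abbrev PSh (C : Type u) [SmallCategory C] [MonoidalCategory C] := DayFunctor Cᵒᵖ (Type u)

lemma isLeftAdjoint_tensorLeft_psh (F : PSh C) : (tensorLeft F).IsLeftAdjoint :=
  have : (LawfulDayConvolutionMonoidalCategoryStruct.ι Cᵒᵖ (Type u) (PSh C)).IsEquivalence :=
    inferInstanceAs (DayFunctor.equiv Cᵒᵖ (Type u)).functor.IsEquivalence
  isLeftAdjoint_tensorLeft (K := Cᵒᵖ) F fun _ =>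
    Functor.EssSurj.mem_essImage (F := LawfulDayConvolutionMonoidalCategoryStruct.ι Cᵒᵖ (Type u) (PSh C)) _

/-- The representable presheaf of `X`. -/
abbrev yo (X : C) : PSh C := .mk (yoneda.obj X)

lemma isInd_of_iso {A B : Cᵒᵖ ⥤ Type u} (e : A ≅ B) (h : IsIndObject A) : IsIndObject B :=
  h.map e.hom

lemma isInd_yo_tensor_yo (X Y : C) : IsIndObject (yo X ⊗ yo Y).functor := by
  let α : (yo X).functor ⊠ (yo Y).functor ⟶ tensor Cᵒᵖ ⋙ (yo (X ⊗ Y)).functor :=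
       { app := fun p => TypeCat.ofHom fun q =>
          ((q.1 : p.1.unop ⟶ X) ⊗ₘ (q.2 : p.2.unop ⟶ Y) : p.1.unop ⊗ p.2.unop ⟶ X ⊗ Y)
         naturality := by
          rintro p p' ⟨a, b⟩
          ext ⟨f, g⟩
          exact (tensorHom_comp_tensorHom _ _ _ _).symm }
  let e : yo (X ⊗ Y) ≅ yo X ⊗ yo Y :=
    { hom := .mk (yonedaEquiv.symm ((DayFunctor.η (yo X) (yo Y)).app (op X, op Y) (𝟙 X, 𝟙 Y)))
      inv := DayFunctor.tensorDesc α
      hom_inv_id := by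
        ext1
        apply yonedaEquiv.injective
        have h1 := congrArg (fun t => t (𝟙 X, 𝟙 Y))
          (DayFunctor.η_comp_tensorDesc_app α (op X) (op Y))
        have h2 : (yo X ⊗ yo Y).functor.map (𝟙 (op (X ⊗ Y)))
            ((DayFunctor.η (yo X) (yo Y)).app (op X, op Y) (𝟙 X, 𝟙 Y)) =
            (DayFunctor.η (yo X) (yo Y)).app (op X, op Y) (𝟙 X, 𝟙 Y) := by
          rw [CategoryTheory.Functor.map_id]; rfl
        exact (congrArg ((DayFunctor.tensorDesc α).natTrans.app (op (X ⊗ Y))) h2).trans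
          (h1.trans (id_tensorHom_id X Y))
      inv_hom_id := by
        apply DayFunctor.tensor_hom_ext
        intro x y
        ext ⟨f, g⟩
        have h1 := congrArg (fun t => t (f, g)) (DayFunctor.η_comp_tensorDesc_app α x y)
        have h2 := dayNat (DayFunctor.η (yo X) (yo Y)) (x := op X) (y := op Y)
          (x' := x) (y' := y) (Quiver.Hom.op f) (Quiver.Hom.op g) (𝟙 X) (𝟙 Y)
        have h3 : ((yo X).functor.map (Quiver.Hom.op f) (𝟙 X),
            (yo Y).functor.map (Quiver.Hom.op g) (𝟙 Y)) = (f, g) :=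
          Prod.ext (Category.comp_id f) (Category.comp_id g)
        rw [h3] at h2
        exact (congrArg ((yonedaEquiv.symm ((DayFunctor.η (yo X) (yo Y)).app (op X, op Y)
          (𝟙 X, 𝟙 Y))).app (x ⊗ y)) h1).trans h2.symm }
  exact isInd_of_iso ((DayFunctor.equiv _ _).functor.mapIso e) (isIndObject_yoneda (X ⊗ Y))

lemma isInd_tensor_of_yo (F : PSh C) (hF : ∀ X : C, IsIndObject (F ⊗ yo X).functor) (G : PSh C)
    (hG : IsIndObject G.functor) : IsIndObject (F ⊗ G).functor := by
  have := isLeftAdjoint_tensorLeft_psh F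
  obtain ⟨⟨P⟩⟩ := hG
  let Φ : (Cᵒᵖ ⥤ Type u) ⥤ (Cᵒᵖ ⥤ Type u) := (DayFunctor.equiv Cᵒᵖ (Type u)).inverse ⋙
    tensorLeft F ⋙ (DayFunctor.equiv Cᵒᵖ (Type u)).functor
  have : PreservesColimitsOfSize.{u, u} Φ := inferInstance
  have hc := isColimitOfPreserves Φ P.isColimit
  exact isInd_of_iso (hc.coconePointUniqueUpToIso (colimit.isColimit _)).symm
    (isIndObject_colimit P.I (P.F ⋙ yoneda ⋙ Φ) (fun i => hF _))

variable [BraidedCategory C]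

lemma isInd_tensor (F G : PSh C) (hF : IsIndObject F.functor) (hG : IsIndObject G.functor) :
    IsIndObject (F ⊗ G).functor := by
  refine isInd_tensor_of_yo F (fun X => ?_) G hG
  let c := LawfulDayConvolutionMonoidalCategoryStruct.convolution Cᵒᵖ (Type u) (PSh C)
  let _ : DayConvolution (yo X).functor F.functor := c (yo X) F
  let _ : DayConvolution F.functor (yo X).functor := c F (yo X)
  exact isInd_of_iso (DayConvolution.braiding (yo X).functor F.functor)
    (isInd_tensor_of_yo (yo X) (isInd_yo_tensor_yo X) F hF)

lemma isInd_unit : IsIndObject (𝟙_ (PSh C)).functor := by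
  let e : yo (𝟙_ C) ≅ 𝟙_ (PSh C) :=
    { hom := .mk (yonedaEquiv.symm (DayFunctor.ν Cᵒᵖ (Type u) PUnit.unit))
      inv := DayFunctor.unitDesc (TypeCat.ofHom fun _ => (𝟙 (𝟙_ C) : _))
      hom_inv_id := by
        ext1
        apply yonedaEquiv.injective
        have h1 := congrArg (fun t => t PUnit.unit) (DayFunctor.ν_comp_unitDesc
          (F := yo (𝟙_ C)) (TypeCat.ofHom fun _ => (𝟙 (𝟙_ C) : _)))
        have h2 : (𝟙_ (PSh C)).functor.map (𝟙 (op (𝟙_ C)))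
            (DayFunctor.ν Cᵒᵖ (Type u) PUnit.unit) = DayFunctor.ν Cᵒᵖ (Type u) PUnit.unit := by
          rw [CategoryTheory.Functor.map_id]; rfl
        exact (congrArg ((DayFunctor.unitDesc (F := yo (𝟙_ C)) (TypeCat.ofHom fun _ =>
          (𝟙 (𝟙_ C) : _))).natTrans.app (op (𝟙_ C))) h2).trans h1
      inv_hom_id := by
        apply DayFunctor.unit_hom_ext
        ext ⟨⟩
        have h1 := congrArg (fun t => t PUnit.unit) (DayFunctor.ν_comp_unitDesc
          (F := yo (𝟙_ C)) (TypeCat.ofHom fun _ => (𝟙 (𝟙_ C) : _)))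
        have h2 : (𝟙_ (PSh C)).functor.map (𝟙 (op (𝟙_ C)))
            (DayFunctor.ν Cᵒᵖ (Type u) PUnit.unit) = DayFunctor.ν Cᵒᵖ (Type u) PUnit.unit := by
          rw [CategoryTheory.Functor.map_id]; rfl
        exact (congrArg ((yonedaEquiv.symm (DayFunctor.ν Cᵒᵖ (Type u) PUnit.unit)).app _)
          h1).trans h2 }
  exact isInd_of_iso ((DayFunctor.equiv _ _).functor.mapIso e) (isIndObject_yoneda (𝟙_ C))

lemma isInd_mem_essImage {F : Cᵒᵖ ⥤ Type u} (h : IsIndObject F) : (Ind.inclusion C).essImage F :=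
  ⟨(Ind.equivalence C).inverse.obj ⟨F, h⟩,
    ⟨(ObjectProperty.ι _).mapIso ((Ind.equivalence C).counitIso.app ⟨F, h⟩)⟩⟩

/-- The tensor product of ind-objects. `Ind C` is the full subcategory of presheaves that are filtered
colimits of representables, and its tensor product is the convolution product of presheaves, that is
`colim X_i ⊗ colim Y_j = colim (X_i ⊗ Y_j)`: it extends the tensor product of `C` and commutes with
filtered colimits in each variable. -/
noncomputable instance : MonoidalCategory (Ind C) :=
  monoidalOfHasDayConvolutions (Ind.inclusion C) Ind.inclusion.fullyFaithful
    (fun F G => isInd_mem_essImage <| isInd_of_iso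
      (DayFunctor.isoPointwiseLeftKanExtension (.mk _) (.mk _))
      (isInd_tensor (.mk _) (.mk _) F.isIndObject_inclusion_obj G.isIndObject_inclusion_obj))
    (isInd_mem_essImage <| isInd_of_iso
      (Functor.leftKanExtensionUnique (𝟙_ (PSh C)).functor (DayFunctor.νNatTrans Cᵒᵖ (Type u)) _
        (Functor.pointwiseLeftKanExtensionUnit _ _)) isInd_unit)

noncomputable instance : LawfulDayConvolutionMonoidalCategoryStruct Cᵒᵖ (Type u) (Ind C) :=
  lawfulDayConvolutionMonoidalCategoryStructOfHasDayConvolutions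
    (Ind.inclusion C) Ind.inclusion.fullyFaithful _ _

end

section

variable {C : Type u} [SmallCategory C] [MonoidalCategory C] [SymmetricCategory C]

instance : (LawfulDayConvolutionMonoidalCategoryStruct.ι Cᵒᵖ (Type u) (Ind C)).Full :=
  inferInstanceAs (Ind.inclusion C).Full

/-- The symmetry of the tensor product of ind-objects. -/
noncomputable instance : SymmetricCategory (Ind C) :=
  have : SymmetricCategory Cᵒᵖ :=
    { symmetry := fun X Y => congrArg Quiver.Hom.op (SymmetricCategory.symmetry X.unop Y.unop) }
  daySymmetric Cᵒᵖ (Ind C)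

variable [Abelian C] [∀ X : C, PreservesFiniteColimits (tensorLeft X)]

lemma isInd_dayHom (F G : Cᵒᵖ ⥤ Type u) (hG : IsIndObject G) : IsIndObject (dayHom F G) := by
  rw [isIndObject_iff_preservesFiniteLimits] at hG ⊢
  have (X : C) : PreservesFiniteLimits (tensorLeft X).op := preservesFiniteLimits_op _
  have (X : C) : PreservesFiniteLimits ((tensorLeft X).op ⋙ G) := comp_preservesFiniteLimits _ _
  have : PreservesFiniteLimits ((curriedTensor Cᵒᵖ).flip ⋙
      ((Functor.whiskeringRight Cᵒᵖ Cᵒᵖ (Type u)).obj G)) :=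
    preservesFiniteLimits_of_evaluation _ fun X =>
      inferInstanceAs (PreservesFiniteLimits ((tensorLeft X.unop).op ⋙ G))
  exact inferInstanceAs (PreservesFiniteLimits (((curriedTensor Cᵒᵖ).flip ⋙
      ((Functor.whiskeringRight Cᵒᵖ Cᵒᵖ (Type u)).obj G)) ⋙ coyoneda.obj (op F)))

instance isLeftAdjoint_tensorLeft_ind (X : Ind C) : (tensorLeft X).IsLeftAdjoint :=
  isLeftAdjoint_tensorLeft (K := Cᵒᵖ) X fun Y =>
    isInd_mem_essImage (isInd_dayHom _ _ Y.isIndObject_inclusion_obj)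

end

end IndTensor

section Modules

open MonObj

variable {C : Type u} [Category.{v} C] [MonoidalCategory C]

section
variable {A : C} [MonObj A]

/-- The action `A ⊗ M ⟶ M` of a monoid `A` on a module `M`. -/
abbrev lact (M : Mod C A) : A ⊗ M.X ⟶ M.X := ModObj.smul (M := A) (X := M.X)

lemma one_lact (M : Mod C A) : η[A] ▷ M.X ≫ lact M = (λ_ M.X).hom := ModObj.one_smul_self A M.X

lemma mul_lact (M : Mod C A) :
    μ[A] ▷ M.X ≫ lact M = (α_ A A M.X).hom ≫ A ◁ lact M ≫ lact M := ModObj.mul_smul_self A M.X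

lemma lact_hom {M N : Mod C A} (f : M ⟶ N) : lact M ≫ f.hom = A ◁ f.hom ≫ lact N :=
  f.isModHom.smul_hom

variable [SymmetricCategory C]

/-- The action of `A` on `M` from the right, `M ⊗ A ≅ A ⊗ M ⟶ M`. -/
def ract (M : Mod C A) : M.X ⊗ A ⟶ M.X := (β_ M.X A).hom ≫ lact M

lemma ract_hom {M N : Mod C A} (f : M ⟶ N) : ract M ≫ f.hom = f.hom ▷ A ≫ ract N := by
  simp [ract]

lemma ract_one (M : Mod C A) : M.X ◁ η[A] ≫ ract M = (ρ_ M.X).hom := by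
  simp [ract]

variable [IsCommMonObj A]

lemma lact_lact_comm (M : Mod C A) :
    A ◁ lact M ≫ lact M = (α_ A A M.X).inv ≫ (β_ A A).hom ▷ M.X ≫ (α_ A A M.X).hom ≫
      A ◁ lact M ≫ lact M := by
  rw [← mul_lact, ← comp_whiskerRight_assoc, IsCommMonObj.mul_comm, mul_lact, Iso.inv_hom_id_assoc]

lemma lact_ract (M : Mod C A) :
    lact M ▷ A ≫ ract M = (α_ A M.X A).hom ≫ A ◁ ract M ≫ lact M := by
  simp only [ract, MonoidalCategory.whiskerLeft_comp, Category.assoc,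
    BraidedCategory.braiding_naturality_left_assoc, BraidedCategory.braiding_tensor_left_hom]
  rw [← lact_lact_comm]

end

variable [SymmetricCategory C] [HasCoequalizers C]
  [∀ X : C, PreservesColimitsOfShape WalkingParallelPair (tensorLeft X)]

instance (X : C) : PreservesColimitsOfShape WalkingParallelPair (tensorRight X) :=
  preservesColimitsOfShape_of_natIso (BraidedCategory.tensorLeftIsoTensorRight X)

variable {A : C} [MonObj A] [IsCommMonObj A]

/-- The object underlying `M ⊗_A N`: the coequalizer of the two morphisms
`(M ⊗ A) ⊗ N ⟶ M ⊗ N` given by the actions of `A` on `M` and on `N`. -/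
noncomputable def tensObj (M N : Mod C A) : C :=
  coequalizer (ract M ▷ N.X) ((α_ M.X A N.X).hom ≫ M.X ◁ lact N)

/-- The projection `M ⊗ N ⟶ M ⊗_A N`. -/
noncomputable def tensπ (M N : Mod C A) : M.X ⊗ N.X ⟶ tensObj M N := coequalizer.π _ _

instance (M N : Mod C A) : Epi (tensπ M N) := inferInstanceAs (Epi (coequalizer.π _ _))

lemma tens_condition (M N : Mod C A) :
    ract M ▷ N.X ≫ tensπ M N = (α_ M.X A N.X).hom ≫ M.X ◁ lact N ≫ tensπ M N := by
  rw [← Category.assoc (α_ _ _ _).hom]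
  exact coequalizer.condition _ _

instance (X : C) (M N : Mod C A) : Epi (X ◁ tensπ M N) :=
  inferInstanceAs (Epi ((tensorLeft X).map (coequalizer.π _ _)))
instance (X : C) (M N : Mod C A) : Epi (tensπ M N ▷ X) :=
  inferInstanceAs (Epi ((tensorRight X).map (coequalizer.π _ _)))

/-- The morphism out of `M ⊗_A N` given by a balanced morphism out of `M ⊗ N`. -/
noncomputable def tensDesc {M N : Mod C A} {W : C} (k : M.X ⊗ N.X ⟶ W)
    (hk : ract M ▷ N.X ≫ k = (α_ M.X A N.X).hom ≫ M.X ◁ lact N ≫ k) :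
    tensObj M N ⟶ W :=
  coequalizer.desc k (by simpa using hk)

@[simp]
lemma tensπ_desc {M N : Mod C A} {W : C} (k : M.X ⊗ N.X ⟶ W)
    (hk : ract M ▷ N.X ≫ k = (α_ M.X A N.X).hom ≫ M.X ◁ lact N ≫ k) :
    tensπ M N ≫ tensDesc k hk = k := coequalizer.π_desc _ _

/-- The morphism out of `X ⊗ (M ⊗_A N)` given by a balanced morphism. -/
noncomputable def tensDescL (X : C) {M N : Mod C A} {W : C} (k : X ⊗ (M.X ⊗ N.X) ⟶ W)
    (hk : X ◁ (ract M ▷ N.X) ≫ k = X ◁ (α_ M.X A N.X).hom ≫ X ◁ (M.X ◁ lact N) ≫ k) :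
    X ⊗ tensObj M N ⟶ W :=
  (PreservesCoequalizer.iso (tensorLeft X) _ _).inv ≫ coequalizer.desc k (by simpa using hk)

@[simp]
lemma tensπ_descL (X : C) {M N : Mod C A} {W : C} (k : X ⊗ (M.X ⊗ N.X) ⟶ W)
    (hk : X ◁ (ract M ▷ N.X) ≫ k = X ◁ (α_ M.X A N.X).hom ≫ X ◁ (M.X ◁ lact N) ≫ k) :
    X ◁ tensπ M N ≫ tensDescL X k hk = k :=
  map_π_preserves_coequalizer_inv_desc (tensorLeft X) _ _ k _

/-- The action of `A` on `M ⊗_A N`, given by the action on `M`. -/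
noncomputable def tensAct (M N : Mod C A) : A ⊗ tensObj M N ⟶ tensObj M N :=
  tensDescL A ((α_ A M.X N.X).inv ≫ lact M ▷ N.X ≫ tensπ M N) (by
    rw [associator_inv_naturality_middle_assoc, associator_inv_naturality_right_assoc,
      whisker_exchange_assoc, ← comp_whiskerRight_assoc, ← cancel_epi (A ◁ (α_ _ _ _).inv)]
    have := lact_ract M
    rw [← Iso.inv_comp_eq] at this
    rw [← this]
    simp [tens_condition])

@[simp]
lemma tensπ_act (M N : Mod C A) :
    A ◁ tensπ M N ≫ tensAct M N = (α_ A M.X N.X).inv ≫ lact M ▷ N.X ≫ tensπ M N :=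
  tensπ_descL _ _ _

/-- The tensor product `M ⊗_A N` of modules over a commutative monoid. -/
noncomputable def tens (M N : Mod C A) : Mod C A where
  X := tensObj M N
  mod :=
    { smul := tensAct M N
      one_smul := by
        dsimp
        rw [← cancel_epi (_ ◁ tensπ M N), whisker_exchange_assoc, tensπ_act,
          associator_inv_naturality_left_assoc, ← comp_whiskerRight_assoc, one_lact]
        simp
      mul_smul := by
        dsimp
        rw [← cancel_epi (_ ◁ tensπ M N), whisker_exchange_assoc, tensπ_act,
          associator_inv_naturality_left_assoc, ← comp_whiskerRight_assoc, mul_lact]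
        simp only [tensor_whiskerLeft, comp_whiskerRight, whisker_assoc, Category.assoc,
          Iso.inv_hom_id_assoc]
        rw [← MonoidalCategory.whiskerLeft_comp_assoc, tensπ_act]
        simp only [MonoidalCategory.whiskerLeft_comp, Category.assoc, tensπ_act]
        simp }


/-- The projection `M ⊗ N ⟶ M ⊗_A N` to the tensor product of modules. -/
noncomputable def tπ (M N : Mod C A) : M.X ⊗ N.X ⟶ (tens M N).X := tensπ M N

instance (M N : Mod C A) : Epi (tπ M N) := inferInstanceAs (Epi (tensπ M N))
instance (X : C) (M N : Mod C A) : Epi (X ◁ tπ M N) := inferInstanceAs (Epi (X ◁ tensπ M N))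
instance (X : C) (M N : Mod C A) : Epi (tπ M N ▷ X) := inferInstanceAs (Epi (tensπ M N ▷ X))
instance (X Y : C) (M N : Mod C A) : Epi ((tπ M N ▷ X) ▷ Y) :=
  inferInstanceAs (Epi ((tensorRight X ⋙ tensorRight Y).map (coequalizer.π _ _)))
instance (X Y : C) (M N : Mod C A) : Epi ((X ◁ tπ M N) ▷ Y) :=
  inferInstanceAs (Epi ((tensorLeft X ⋙ tensorRight Y).map (coequalizer.π _ _)))
instance (X Y : C) (M N : Mod C A) : Epi (X ◁ (Y ◁ tπ M N)) :=
  inferInstanceAs (Epi ((tensorLeft Y ⋙ tensorLeft X).map (coequalizer.π _ _)))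

lemma tπ_condition (M N : Mod C A) :
    ract M ▷ N.X ≫ tπ M N = (α_ M.X A N.X).hom ≫ M.X ◁ lact N ≫ tπ M N :=
  tens_condition M N

lemma tπ_lact (M N : Mod C A) :
    A ◁ tπ M N ≫ lact (tens M N) = (α_ A M.X N.X).inv ≫ lact M ▷ N.X ≫ tπ M N :=
  tensπ_act M N

lemma tπ_ract (M N : Mod C A) :
    tπ M N ▷ A ≫ ract (tens M N) = (α_ M.X N.X A).hom ≫ M.X ◁ ract N ≫ tπ M N := by
  have h : M.X ◁ lact N ≫ tπ M N = (α_ M.X A N.X).inv ≫ ract M ▷ N.X ≫ tπ M N := by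
    rw [tπ_condition, Iso.inv_hom_id_assoc]
  rw [ract, BraidedCategory.braiding_naturality_left_assoc, tπ_lact, ract,
    MonoidalCategory.whiskerLeft_comp_assoc, h]
  simp [ract]

lemma tens_hom_ext {M N P : Mod C A} {f g : tens M N ⟶ P} (h : tπ M N ≫ f.hom = tπ M N ≫ g.hom) :
    f = g :=
  Mod.hom_ext _ _ ((cancel_epi (tπ M N)).1 h)

/-- The morphism out of `M ⊗_A N` given by a balanced morphism out of `M ⊗ N`. -/
noncomputable def tDesc {M N : Mod C A} {W : C} (k : M.X ⊗ N.X ⟶ W)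
    (hk : ract M ▷ N.X ≫ k = (α_ M.X A N.X).hom ≫ M.X ◁ lact N ≫ k) : (tens M N).X ⟶ W :=
  coequalizer.desc k (by simpa using hk)

@[simp]
lemma tπ_desc {M N : Mod C A} {W : C} (k : M.X ⊗ N.X ⟶ W)
    (hk : ract M ▷ N.X ≫ k = (α_ M.X A N.X).hom ≫ M.X ◁ lact N ≫ k) :
    tπ M N ≫ tDesc k hk = k := coequalizer.π_desc _ _

/-- The morphism out of `X ⊗ (M ⊗_A N)` given by a balanced morphism. -/
noncomputable def tDescL {X : C} {M N : Mod C A} {W : C} (k : X ⊗ (M.X ⊗ N.X) ⟶ W)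
    (hk : X ◁ (ract M ▷ N.X) ≫ k = X ◁ (α_ M.X A N.X).hom ≫ X ◁ (M.X ◁ lact N) ≫ k) :
    X ⊗ (tens M N).X ⟶ W := tensDescL X k hk

@[simp]
lemma tπ_descL {X : C} {M N : Mod C A} {W : C} (k : X ⊗ (M.X ⊗ N.X) ⟶ W)
    (hk : X ◁ (ract M ▷ N.X) ≫ k = X ◁ (α_ M.X A N.X).hom ≫ X ◁ (M.X ◁ lact N) ≫ k) :
    X ◁ tπ M N ≫ tDescL k hk = k := tensπ_descL X k hk

/-- The morphism out of `(M ⊗_A N) ⊗ X` given by a balanced morphism. -/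
noncomputable def tDescR {X : C} {M N : Mod C A} {W : C} (k : (M.X ⊗ N.X) ⊗ X ⟶ W)
    (hk : (ract M ▷ N.X) ▷ X ≫ k = (α_ M.X A N.X).hom ▷ X ≫ (M.X ◁ lact N) ▷ X ≫ k) :
    (tens M N).X ⊗ X ⟶ W :=
  (PreservesCoequalizer.iso (tensorRight X) _ _).inv ≫ coequalizer.desc k (by simpa using hk)

@[simp]
lemma tπ_descR {X : C} {M N : Mod C A} {W : C} (k : (M.X ⊗ N.X) ⊗ X ⟶ W)
    (hk : (ract M ▷ N.X) ▷ X ≫ k = (α_ M.X A N.X).hom ▷ X ≫ (M.X ◁ lact N) ▷ X ≫ k) :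
    tπ M N ▷ X ≫ tDescR k hk = k :=
  map_π_preserves_coequalizer_inv_desc (tensorRight X) _ _ k _

/-- The morphism of modules out of `M ⊗_A N` given by a balanced linear morphism out of `M ⊗ N`. -/
noncomputable def tensHomDesc {M N P : Mod C A} (k : M.X ⊗ N.X ⟶ P.X)
    (hk : ract M ▷ N.X ≫ k = (α_ M.X A N.X).hom ≫ M.X ◁ lact N ≫ k)
    (hl : lact M ▷ N.X ≫ k = (α_ A M.X N.X).hom ≫ A ◁ k ≫ lact P) : tens M N ⟶ P :=
  Mod.Hom.mk' (tDesc k hk) (by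
    change lact (tens M N) ≫ _ = A ◁ _ ≫ lact P
    rw [← cancel_epi (A ◁ tπ M N), reassoc_of% @tπ_lact, tπ_desc, hl,
      ← MonoidalCategory.whiskerLeft_comp_assoc, tπ_desc, Iso.inv_hom_id_assoc])

@[simp]
lemma tπ_homDesc {M N P : Mod C A} (k : M.X ⊗ N.X ⟶ P.X)
    (hk : ract M ▷ N.X ≫ k = (α_ M.X A N.X).hom ≫ M.X ◁ lact N ≫ k)
    (hl : lact M ▷ N.X ≫ k = (α_ A M.X N.X).hom ≫ A ◁ k ≫ lact P) :
    tπ M N ≫ (tensHomDesc k hk hl).hom = k :=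
  tπ_desc k hk

/-- A morphism of modules whose underlying morphism is invertible is an isomorphism. -/
@[simps]
def modIsoMk {M N : Mod C A} (f : M ⟶ N) (g : N.X ⟶ M.X) (h₁ : f.hom ≫ g = 𝟙 _)
    (h₂ : g ≫ f.hom = 𝟙 _) : M ≅ N where
  hom := f
  inv := Mod.Hom.mk' g (by
    change lact N ≫ g = A ◁ g ≫ lact M
    have h : lact M ≫ f.hom = A ◁ f.hom ≫ lact N := lact_hom f
    calc lact N ≫ g = A ◁ (g ≫ f.hom) ≫ lact N ≫ g := by rw [h₂]; simp
      _ = A ◁ g ≫ lact M ≫ f.hom ≫ g := by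
        rw [MonoidalCategory.whiskerLeft_comp_assoc, reassoc_of% h]
      _ = _ := by rw [h₁, Category.comp_id])
  hom_inv_id := Mod.hom_ext _ _ h₁
  inv_hom_id := Mod.hom_ext _ _ h₂

/-- `M ⊗_A f`. -/
noncomputable def tensWL (M : Mod C A) {N P : Mod C A} (f : N ⟶ P) : tens M N ⟶ tens M P :=
  tensHomDesc (M.X ◁ f.hom ≫ tπ M P)
    (by
      rw [← whisker_exchange_assoc, tπ_condition, ← MonoidalCategory.whiskerLeft_comp_assoc,
        lact_hom]
      simp)
    (by
      rw [MonoidalCategory.whiskerLeft_comp_assoc, tπ_lact, ← whisker_exchange_assoc]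
      simp)

@[simp]
lemma tπ_WL (M : Mod C A) {N P : Mod C A} (f : N ⟶ P) :
    tπ M N ≫ (tensWL M f).hom = M.X ◁ f.hom ≫ tπ M P := tπ_homDesc _ _ _

/-- `f ⊗_A P`. -/
noncomputable def tensWR {M N : Mod C A} (f : M ⟶ N) (P : Mod C A) : tens M P ⟶ tens N P :=
  tensHomDesc (f.hom ▷ P.X ≫ tπ N P)
    (by
      rw [← comp_whiskerRight_assoc, ract_hom, comp_whiskerRight_assoc, tπ_condition,
        whisker_exchange_assoc]
      simp)
    (by
      rw [MonoidalCategory.whiskerLeft_comp_assoc, tπ_lact, ← comp_whiskerRight_assoc,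
        lact_hom]
      simp)

@[simp]
lemma tπ_WR {M N : Mod C A} (f : M ⟶ N) (P : Mod C A) :
    tπ M P ≫ (tensWR f P).hom = f.hom ▷ P.X ≫ tπ N P := tπ_homDesc _ _ _

lemma lact_braid_tπ (M N : Mod C A) : lact M ▷ N.X ≫ (β_ M.X N.X).hom ≫ tπ N M =
    (α_ A M.X N.X).hom ≫ A ◁ (β_ M.X N.X).hom ≫ (α_ A N.X M.X).inv ≫ lact N ▷ M.X ≫ tπ N M := by
  have h : N.X ◁ lact M ≫ tπ N M = (α_ N.X A M.X).inv ≫ ract N ▷ M.X ≫ tπ N M := by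
    rw [tπ_condition, Iso.inv_hom_id_assoc]
  rw [BraidedCategory.braiding_naturality_left_assoc, h]
  have h2 : (β_ A N.X).hom ▷ M.X ≫ ract N ▷ M.X = lact N ▷ M.X := by
    rw [← comp_whiskerRight, ract, SymmetricCategory.symmetry_assoc]
  simp only [BraidedCategory.braiding_tensor_left_hom, Category.assoc, Iso.hom_inv_id_assoc,
    reassoc_of% h2]

/-- The symmetry `M ⊗_A N ⟶ N ⊗_A M`. -/
noncomputable def tensBraidHom (M N : Mod C A) : tens M N ⟶ tens N M :=
  tensHomDesc ((β_ M.X N.X).hom ≫ tπ N M)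
    (by
      rw [ract, comp_whiskerRight_assoc, lact_braid_tπ,
        BraidedCategory.braiding_naturality_right_assoc]
      simp)
    (by
      rw [lact_braid_tπ, MonoidalCategory.whiskerLeft_comp_assoc, tπ_lact])

@[simp]
lemma tπ_braidHom (M N : Mod C A) :
    tπ M N ≫ (tensBraidHom M N).hom = (β_ M.X N.X).hom ≫ tπ N M := tπ_homDesc _ _ _

/-- The monoid `A` as a module over itself. -/
abbrev regMod (A : C) [MonObj A] : Mod C A := { X := A, mod := ModObj.regular A }

lemma lact_regular : lact (regMod A) = μ[A] := rfl

lemma ract_regular : ract (regMod A) = μ[A] := by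
  exact IsCommMonObj.mul_comm A

/-- The left unit isomorphism `A ⊗_A M ≅ M`. -/
noncomputable def tensLU (M : Mod C A) : tens (regMod A) M ≅ M :=
  modIsoMk (tensHomDesc (lact M)
    (by rw [ract_regular]; exact mul_lact M)
    (by rw [lact_regular]; exact mul_lact M))
    ((λ_ M.X).inv ≫ η[A] ▷ M.X ≫ tπ (regMod A) M)
    (by
      have h : A ◁ lact M ≫ tπ (regMod A) M = (α_ A A M.X).inv ≫ μ[A] ▷ M.X ≫ tπ (regMod A) M := by
        have := tπ_condition (regMod A) M
        rw [ract_regular] at this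
        rw [this, Iso.inv_hom_id_assoc]
      rw [← cancel_epi (tπ _ _), reassoc_of% @tπ_homDesc, leftUnitor_inv_naturality_assoc,
        whisker_exchange_assoc, h, associator_inv_naturality_left_assoc,
        ← comp_whiskerRight_assoc, MonObj.one_mul]
      simp)
    (by rw [Category.assoc, Category.assoc, tπ_homDesc, one_lact, Iso.inv_hom_id])

@[simp]
lemma tπ_LUHom (M : Mod C A) : tπ (regMod A) M ≫ (tensLU M).hom.hom = lact M :=
  by rw [tensLU, modIsoMk_hom, tπ_homDesc]

lemma ract_ract (M : Mod C A) :
    ract M ▷ A ≫ ract M = (α_ M.X A A).hom ≫ M.X ◁ μ[A] ≫ ract M := by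
  have h := lact_ract M
  rw [ract, BraidedCategory.braiding_naturality_right_assoc, mul_lact, comp_whiskerRight_assoc]
  rw [ract] at h
  rw [h]
  simp

/-- The right unit isomorphism `M ⊗_A A ≅ M`. -/
noncomputable def tensRU (M : Mod C A) : tens M (regMod A) ≅ M :=
  modIsoMk (tensHomDesc (ract M)
    (by rw [lact_regular]; exact ract_ract M)
    (lact_ract M))
    ((ρ_ M.X).inv ≫ M.X ◁ η[A] ≫ tπ M (regMod A))
    (by
      have h : ract M ▷ A ≫ tπ M (regMod A) = (α_ M.X A A).hom ≫ M.X ◁ μ[A] ≫ tπ M (regMod A) :=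
        tπ_condition M (regMod A)
      rw [← cancel_epi (tπ _ _), reassoc_of% @tπ_homDesc, rightUnitor_inv_naturality_assoc,
        ← whisker_exchange_assoc, h]
      simp [← MonoidalCategory.whiskerLeft_comp_assoc])
    (by rw [Category.assoc, Category.assoc, tπ_homDesc, ract_one, Iso.inv_hom_id])

@[simp]
lemma tπ_RUHom (M : Mod C A) : tπ M (regMod A) ≫ (tensRU M).hom.hom = ract M :=
  by rw [tensRU, modIsoMk_hom, tπ_homDesc]

/-- Auxiliary morphism `(M ⊗_A N) ⊗ P ⟶ M ⊗_A (N ⊗_A P)` for the associator. -/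
noncomputable def assocAux (M N P : Mod C A) : (tens M N).X ⊗ P.X ⟶ (tens M (tens N P)).X :=
  tDescR ((α_ M.X N.X P.X).hom ≫ M.X ◁ tπ N P ≫ tπ M (tens N P)) (by
    rw [associator_naturality_left_assoc, ← whisker_exchange_assoc, tπ_condition]
    simp only [tensor_whiskerLeft, Category.assoc, Iso.inv_hom_id_assoc]
    rw [← MonoidalCategory.whiskerLeft_comp_assoc, tπ_lact]
    simp)

@[simp]
lemma tπ_assocAux (M N P : Mod C A) : tπ M N ▷ P.X ≫ assocAux M N P =
    (α_ M.X N.X P.X).hom ≫ M.X ◁ tπ N P ≫ tπ M (tens N P) := tπ_descR _ _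

/-- Auxiliary morphism `M ⊗ (N ⊗_A P) ⟶ (M ⊗_A N) ⊗_A P` for the associator. -/
noncomputable def assocAux' (M N P : Mod C A) : M.X ⊗ (tens N P).X ⟶ (tens (tens M N) P).X :=
  tDescL ((α_ M.X N.X P.X).inv ≫ tπ M N ▷ P.X ≫ tπ (tens M N) P) (by
    have h : M.X ◁ ract N ≫ tπ M N = (α_ _ _ _).inv ≫ tπ M N ▷ A ≫ ract (tens M N) := by
      rw [tπ_ract, Iso.inv_hom_id_assoc]
    rw [associator_inv_naturality_middle_assoc, ← comp_whiskerRight_assoc, h]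
    simp only [comp_whiskerRight, Category.assoc, tπ_condition]
    rw [associator_inv_naturality_right_assoc, whisker_exchange_assoc]
    simp)

@[simp]
lemma tπ_assocAux' (M N P : Mod C A) : M.X ◁ tπ N P ≫ assocAux' M N P =
    (α_ M.X N.X P.X).inv ≫ tπ M N ▷ P.X ≫ tπ (tens M N) P := tπ_descL _ _

lemma assocAux_condition (M N P : Mod C A) : ract (tens M N) ▷ P.X ≫ assocAux M N P =
    (α_ _ _ _).hom ≫ (tens M N).X ◁ lact P ≫ assocAux M N P := by
  rw [← cancel_epi ((tπ M N ▷ A) ▷ P.X), ← comp_whiskerRight_assoc, tπ_ract,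
    associator_naturality_left_assoc, ← whisker_exchange_assoc, tπ_assocAux]
  simp only [comp_whiskerRight, Category.assoc, tπ_assocAux]
  rw [associator_naturality_middle_assoc, ← MonoidalCategory.whiskerLeft_comp_assoc, tπ_condition]
  simp

lemma assocAux_lact (M N P : Mod C A) : lact (tens M N) ▷ P.X ≫ assocAux M N P =
    (α_ _ _ _).hom ≫ A ◁ assocAux M N P ≫ lact (tens M (tens N P)) := by
  rw [← cancel_epi ((A ◁ tπ M N) ▷ P.X), ← comp_whiskerRight_assoc, tπ_lact,
    associator_naturality_middle_assoc, ← MonoidalCategory.whiskerLeft_comp_assoc, tπ_assocAux]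
  simp only [comp_whiskerRight, Category.assoc, tπ_assocAux, MonoidalCategory.whiskerLeft_comp,
    tπ_lact]
  rw [associator_inv_naturality_right_assoc, whisker_exchange_assoc]
  simp

lemma assocAux'_condition (M N P : Mod C A) : ract M ▷ (tens N P).X ≫ assocAux' M N P =
    (α_ _ _ _).hom ≫ M.X ◁ lact (tens N P) ≫ assocAux' M N P := by
  rw [← cancel_epi ((M.X ⊗ A) ◁ tπ N P), whisker_exchange_assoc, tπ_assocAux',
    associator_naturality_right_assoc, ← MonoidalCategory.whiskerLeft_comp_assoc, tπ_lact]
  simp only [MonoidalCategory.whiskerLeft_comp, Category.assoc, tπ_assocAux']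
  rw [associator_inv_naturality_left_assoc, ← comp_whiskerRight_assoc, tπ_condition]
  simp

/-- The associativity isomorphism of the tensor product over `A`. -/
noncomputable def tensAssoc (M N P : Mod C A) : tens (tens M N) P ≅ tens M (tens N P) :=
  modIsoMk (tensHomDesc (assocAux M N P) (assocAux_condition M N P) (assocAux_lact M N P))
    (tDesc (assocAux' M N P) (assocAux'_condition M N P))
    (by
      rw [← cancel_epi (tπ _ _), ← cancel_epi (tπ M N ▷ P.X), reassoc_of% @tπ_homDesc,
        reassoc_of% @tπ_assocAux, tπ_desc, tπ_assocAux', Iso.hom_inv_id_assoc, Category.comp_id])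
    (by
      rw [← cancel_epi (tπ _ _), ← cancel_epi (M.X ◁ tπ N P), reassoc_of% @tπ_desc,
        reassoc_of% @tπ_assocAux', tπ_homDesc, tπ_assocAux, Iso.inv_hom_id_assoc,
        Category.comp_id])

@[simp]
lemma tπ_assoc (M N P : Mod C A) : tπ M N ▷ P.X ≫ tπ (tens M N) P ≫ (tensAssoc M N P).hom.hom =
    (α_ M.X N.X P.X).hom ≫ M.X ◁ tπ N P ≫ tπ M (tens N P) := by
  rw [tensAssoc, modIsoMk_hom, tπ_homDesc, tπ_assocAux]

/-- The tensor product over `A`, with unit `A`. -/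
noncomputable instance : MonoidalCategoryStruct (Mod C A) where
  tensorObj := tens
  whiskerLeft M _ _ f := tensWL M f
  whiskerRight f M := tensWR f M
  tensorUnit := regMod A
  associator := tensAssoc
  leftUnitor := tensLU
  rightUnitor := tensRU


/-- The canonical epimorphism `M ⊗ N ⟶ M ⊗_A N`. -/
noncomputable def modπ (M N : Mod C A) : M.X ⊗ N.X ⟶ (M ⊗ N).X := tπ M N

instance (M N : Mod C A) : Epi (modπ M N) := inferInstanceAs (Epi (tπ M N))
instance (X : C) (M N : Mod C A) : Epi (X ◁ modπ M N) := inferInstanceAs (Epi (X ◁ tπ M N))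
instance (X : C) (M N : Mod C A) : Epi (modπ M N ▷ X) := inferInstanceAs (Epi (tπ M N ▷ X))
instance (X Y : C) (M N : Mod C A) : Epi ((modπ M N ▷ X) ▷ Y) :=
  inferInstanceAs (Epi ((tπ M N ▷ X) ▷ Y))

lemma modπ_condition (M N : Mod C A) :
    ract M ▷ N.X ≫ modπ M N = (α_ M.X A N.X).hom ≫ M.X ◁ lact N ≫ modπ M N :=
  tπ_condition M N

lemma modπ_lact (M N : Mod C A) :
    A ◁ modπ M N ≫ lact (M ⊗ N) = (α_ A M.X N.X).inv ≫ lact M ▷ N.X ≫ modπ M N :=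
  tπ_lact M N

lemma modπ_whiskerLeft (M : Mod C A) {N P : Mod C A} (f : N ⟶ P) :
    modπ M N ≫ (M ◁ f).hom = M.X ◁ f.hom ≫ modπ M P := tπ_WL M f

lemma modπ_whiskerRight {M N : Mod C A} (f : M ⟶ N) (P : Mod C A) :
    modπ M P ≫ (f ▷ P).hom = f.hom ▷ P.X ≫ modπ N P := tπ_WR f P

lemma modπ_tensorHom {M N P Q : Mod C A} (f : M ⟶ N) (g : P ⟶ Q) :
    modπ M P ≫ (f ⊗ₘ g).hom = (f.hom ⊗ₘ g.hom) ≫ modπ N Q := by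
  have h : (f ⊗ₘ g).hom = (f ▷ P).hom ≫ (N ◁ g).hom := rfl
  rw [h, reassoc_of% @modπ_whiskerRight, modπ_whiskerLeft, MonoidalCategory.tensorHom_def,
    Category.assoc]

lemma modπ_associator (M N P : Mod C A) :
    modπ M N ▷ P.X ≫ modπ (M ⊗ N) P ≫ (α_ M N P).hom.hom =
      (α_ M.X N.X P.X).hom ≫ M.X ◁ modπ N P ≫ modπ M (N ⊗ P) := tπ_assoc M N P

lemma modπ_leftUnitor (M : Mod C A) : modπ (𝟙_ (Mod C A)) M ≫ (λ_ M).hom.hom = lact M :=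
  tπ_LUHom M

lemma modπ_rightUnitor (M : Mod C A) : modπ M (𝟙_ (Mod C A)) ≫ (ρ_ M).hom.hom = ract M :=
  tπ_RUHom M

lemma mod_hom_ext {M N P : Mod C A} {f g : M ⊗ N ⟶ P}
    (h : modπ M N ≫ f.hom = modπ M N ≫ g.hom) : f = g := tens_hom_ext h

lemma mod_hom_ext₃ {M N P Q : Mod C A} {f g : (M ⊗ N) ⊗ P ⟶ Q}
    (h : modπ M N ▷ P.X ≫ modπ (M ⊗ N) P ≫ f.hom = modπ M N ▷ P.X ≫ modπ (M ⊗ N) P ≫ g.hom) :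
    f = g :=
  mod_hom_ext ((cancel_epi (modπ M N ▷ P.X)).1 h)

lemma mod_hom_ext₃' {M N P Q : Mod C A} {f g : M ⊗ (N ⊗ P) ⟶ Q}
    (h : M.X ◁ modπ N P ≫ modπ M (N ⊗ P) ≫ f.hom = M.X ◁ modπ N P ≫ modπ M (N ⊗ P) ≫ g.hom) :
    f = g :=
  mod_hom_ext ((cancel_epi (M.X ◁ modπ N P)).1 h)

lemma mod_hom_ext₄ {M N P Q R : Mod C A} {f g : ((M ⊗ N) ⊗ P) ⊗ Q ⟶ R}
    (h : (modπ M N ▷ P.X) ▷ Q.X ≫ modπ (M ⊗ N) P ▷ Q.X ≫ modπ ((M ⊗ N) ⊗ P) Q ≫ f.hom =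
      (modπ M N ▷ P.X) ▷ Q.X ≫ modπ (M ⊗ N) P ▷ Q.X ≫ modπ ((M ⊗ N) ⊗ P) Q ≫ g.hom) : f = g :=
  mod_hom_ext₃ ((cancel_epi ((modπ M N ▷ P.X) ▷ Q.X)).1 h)

/-- The tensor product over a commutative monoid `A` makes `A`-modules a monoidal category. -/
noncomputable instance : MonoidalCategory (Mod C A) where
  whiskerLeft_id M N := mod_hom_ext (by simp [modπ_whiskerLeft])
  id_whiskerRight M N := mod_hom_ext (by simp [modπ_whiskerRight])
  tensorHom_def f g := rfl
  id_tensorHom_id M N := mod_hom_ext (by simp [modπ_tensorHom])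
  tensorHom_comp_tensorHom f g h k := mod_hom_ext (by
    rw [Mod.comp_hom', reassoc_of% @modπ_tensorHom, modπ_tensorHom, modπ_tensorHom,
      tensorHom_comp_tensorHom_assoc, Mod.comp_hom', Mod.comp_hom'])
  associator_naturality f g h := mod_hom_ext₃ (by
    rw [Mod.comp_hom', Mod.comp_hom', reassoc_of% @modπ_tensorHom, reassoc_of% @modπ_associator,
      modπ_tensorHom, whiskerRight_comp_tensorHom_assoc, whiskerLeft_comp_tensorHom_assoc,
      modπ_tensorHom, modπ_tensorHom,
      ← tensorHom_comp_whiskerRight_assoc, modπ_associator, associator_naturality_assoc,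
      ← tensorHom_comp_whiskerLeft_assoc])
  leftUnitor_naturality f := mod_hom_ext (by
    rw [Mod.comp_hom', Mod.comp_hom', reassoc_of% @modπ_whiskerLeft, modπ_leftUnitor,
      reassoc_of% @modπ_leftUnitor, lact_hom]
    rfl)
  rightUnitor_naturality f := mod_hom_ext (by
    rw [Mod.comp_hom', Mod.comp_hom', reassoc_of% @modπ_whiskerRight, modπ_rightUnitor,
      reassoc_of% @modπ_rightUnitor, ract_hom]
    rfl)
  pentagon W X Y Z := mod_hom_ext₄ (by
    simp only [Mod.comp_hom']
    rw [reassoc_of% @modπ_whiskerRight, ← comp_whiskerRight_assoc, ← comp_whiskerRight_assoc,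
      Category.assoc, modπ_associator]
    simp only [comp_whiskerRight, Category.assoc]
    rw [reassoc_of% @modπ_associator, modπ_whiskerLeft, associator_naturality_middle_assoc,
      ← MonoidalCategory.whiskerLeft_comp_assoc, ← MonoidalCategory.whiskerLeft_comp_assoc,
      Category.assoc, modπ_associator, reassoc_of% @modπ_associator,
      associator_naturality_left_assoc, ← whisker_exchange_assoc, modπ_associator]
    simp)
  triangle X Y := mod_hom_ext₃ (by
    rw [Mod.comp_hom', reassoc_of% @modπ_associator, modπ_whiskerLeft, modπ_whiskerRight,
      ← MonoidalCategory.whiskerLeft_comp_assoc, modπ_leftUnitor,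
      ← comp_whiskerRight_assoc, modπ_rightUnitor, modπ_condition]
    rfl)

lemma modπ_braidHom (M N : Mod C A) :
    modπ M N ≫ (tensBraidHom M N : M ⊗ N ⟶ N ⊗ M).hom = (β_ M.X N.X).hom ≫ modπ N M :=
  tπ_braidHom M N

/-- The braiding of `A`-modules, induced by the one of `C`. -/
noncomputable def modBraiding (M N : Mod C A) : M ⊗ N ≅ N ⊗ M where
  hom := tensBraidHom M N
  inv := tensBraidHom N M
  hom_inv_id := mod_hom_ext (by
    rw [Mod.comp_hom', reassoc_of% @modπ_braidHom, modπ_braidHom,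
      SymmetricCategory.symmetry_assoc, Mod.id_hom', Category.comp_id])
  inv_hom_id := mod_hom_ext (by
    rw [Mod.comp_hom', reassoc_of% @modπ_braidHom, modπ_braidHom,
      SymmetricCategory.symmetry_assoc, Mod.id_hom', Category.comp_id])

lemma modπ_braiding (M N : Mod C A) :
    modπ M N ≫ (modBraiding M N).hom.hom = (β_ M.X N.X).hom ≫ modπ N M :=
  tπ_braidHom M N

lemma modπ_associator_inv (M N P : Mod C A) :
    M.X ◁ modπ N P ≫ modπ M (N ⊗ P) ≫ (α_ M N P).inv.hom =
      (α_ M.X N.X P.X).inv ≫ modπ M N ▷ P.X ≫ modπ (M ⊗ N) P := by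
  have h : (α_ M N P).hom.hom ≫ (α_ M N P).inv.hom = 𝟙 _ := by
    rw [← Mod.comp_hom', Iso.hom_inv_id]; rfl
  rw [Iso.eq_inv_comp, ← reassoc_of% modπ_associator M N P, h, Category.comp_id]

/-- The tensor product over a commutative monoid `A` makes `A`-modules a symmetric monoidal
category. -/
noncomputable instance : SymmetricCategory (Mod C A) where
  braiding := modBraiding
  braiding_naturality_left f Z := mod_hom_ext (by
    rw [Mod.comp_hom', Mod.comp_hom', reassoc_of% @modπ_whiskerRight, modπ_braiding,
      reassoc_of% @modπ_braiding, modπ_whiskerLeft, BraidedCategory.braiding_naturality_left_assoc])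
  braiding_naturality_right X Y Z f := mod_hom_ext (by
    rw [Mod.comp_hom', Mod.comp_hom', reassoc_of% @modπ_whiskerLeft, modπ_braiding,
      reassoc_of% @modπ_braiding, modπ_whiskerRight,
      BraidedCategory.braiding_naturality_right_assoc])
  hexagon_forward X Y Z := mod_hom_ext₃ (by
    simp only [Mod.comp_hom']
    rw [reassoc_of% @modπ_associator, reassoc_of% @modπ_braiding,
      BraidedCategory.braiding_naturality_right_assoc, modπ_associator,
      reassoc_of% @modπ_whiskerRight, ← comp_whiskerRight_assoc, modπ_braiding,
      comp_whiskerRight_assoc, reassoc_of% @modπ_associator, modπ_whiskerLeft,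
      ← MonoidalCategory.whiskerLeft_comp_assoc, modπ_braiding]
    simp)
  hexagon_reverse X Y Z := mod_hom_ext₃' (by
    simp only [Mod.comp_hom']
    rw [reassoc_of% @modπ_associator_inv, reassoc_of% @modπ_braiding,
      BraidedCategory.braiding_naturality_left_assoc, modπ_associator_inv,
      reassoc_of% @modπ_whiskerLeft, ← MonoidalCategory.whiskerLeft_comp_assoc, modπ_braiding,
      MonoidalCategory.whiskerLeft_comp_assoc, reassoc_of% @modπ_associator_inv, modπ_whiskerRight,
      ← comp_whiskerRight_assoc, modπ_braiding]
    simp)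
  symmetry M N := (modBraiding M N).hom_inv_id

section ExtensionOfScalars

variable {B : C} [MonObj B] [IsCommMonObj B] (f : A ⟶ B) [IsMonHom f]

/-- `B` as an `A`-module along a morphism of commutative monoids `f : A ⟶ B`. -/
abbrev restrMod : Mod C A where
  X := B
  mod :=
    letI : ModObj B B := .regular B
    Mod.scalarRestriction f B

lemma lact_restr : lact (restrMod f) = f ▷ B ≫ μ[B] := rfl

lemma whiskerLeft_ract_restr :
    B ◁ ract (restrMod f) ≫ μ[B] = (α_ B B A).inv ≫ μ[B] ▷ A ≫ ract (restrMod f) := by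
  have h : ract (restrMod f) = B ◁ f ≫ μ[B] := by
    rw [ract, lact_restr]
    change (β_ B A).hom ≫ f ▷ B ≫ μ[B] = _
    rw [← BraidedCategory.braiding_naturality_right_assoc, IsCommMonObj.mul_comm]
  rw [h]
  change B ◁ (B ◁ f ≫ μ[B]) ≫ μ[B] = (α_ B B A).inv ≫ μ[B] ▷ A ≫ B ◁ f ≫ μ[B]
  rw [← whisker_exchange_assoc, MonObj.mul_assoc]
  simp

/-- The action of `B` on `B ⊗_A M` by multiplication on the left factor. -/
noncomputable def extAct (M : Mod C A) : B ⊗ (tens (restrMod f) M).X ⟶ (tens (restrMod f) M).X :=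
  tDescL ((α_ B B M.X).inv ≫ μ[B] ▷ M.X ≫ tπ (restrMod f) M) (by
    rw [associator_inv_naturality_middle_assoc, ← comp_whiskerRight_assoc, whiskerLeft_ract_restr]
    simp only [comp_whiskerRight, Category.assoc, tπ_condition]
    rw [associator_inv_naturality_right_assoc, whisker_exchange_assoc]
    simp)

lemma tπ_extAct (M : Mod C A) : B ◁ tπ (restrMod f) M ≫ extAct f M =
    (α_ B B M.X).inv ≫ μ[B] ▷ M.X ≫ tπ (restrMod f) M :=
  tπ_descL _ _

/-- Extension of scalars: the `B`-module `M_B = B ⊗_A M`. -/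
noncomputable def extScalars (M : Mod C A) : Mod C B where
  X := (tens (restrMod f) M).X
  mod :=
    { smul := extAct f M
      one_smul := by
        dsimp
        rw [← cancel_epi (_ ◁ tπ (restrMod f) M), whisker_exchange_assoc, tπ_extAct,
          associator_inv_naturality_left_assoc, ← comp_whiskerRight_assoc, MonObj.one_mul]
        simp
      mul_smul := by
        dsimp
        rw [← cancel_epi (_ ◁ tπ (restrMod f) M), whisker_exchange_assoc, tπ_extAct,
          associator_inv_naturality_left_assoc, ← comp_whiskerRight_assoc, MonObj.mul_assoc]
        simp only [tensor_whiskerLeft, comp_whiskerRight, whisker_assoc, Category.assoc,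
          Iso.inv_hom_id_assoc]
        rw [← MonoidalCategory.whiskerLeft_comp_assoc, tπ_extAct]
        simp only [MonoidalCategory.whiskerLeft_comp, Category.assoc, tπ_extAct]
        simp }

end ExtensionOfScalars

end Modules

section TensorPowers

variable {D : Type u} [Category.{v} D] [MonoidalCategory D]

/-- The tensor power `X^{⊗ n} = X ⊗ (X ⊗ ⋯)`. -/
def tpow (X : D) : ℕ → D
  | 0 => 𝟙_ D
  | n + 1 => X ⊗ tpow X n

variable [SymmetricCategory D]

/-- The morphism `X^{⊗ (n+1)} ⟶ X^{⊗ (n+1)}` that moves the factor in position `0` to position `i`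
and keeps the order of the other factors. -/
def insertAt (X : D) : (n : ℕ) → (i : ℕ) → (X ⊗ tpow X n ⟶ X ⊗ tpow X n)
  | _, 0 => 𝟙 _
  | 0, _ + 1 => 𝟙 _
  | n + 1, i + 1 => ((α_ X X (tpow X n)).inv ≫ (β_ X X).hom ▷ tpow X n ≫ (α_ X X (tpow X n)).hom) ≫
      X ◁ insertAt X n i

/-- For a permutation `σ` of `{0, …, n}`, the permutation `σ'` of `{0, …, n-1}` that `σ` induces
from the complement of `0` to the complement of `σ 0`, both identified with `{0, …, n-1}` in an
order preserving way. -/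
def tailPerm {n : ℕ} (σ : Equiv.Perm (Fin (n + 1))) : Equiv.Perm (Fin n) :=
  Equiv.removeNone ((finSuccEquiv' 0).symm.trans (σ.trans (finSuccEquiv' (σ 0))))

lemma succAbove_tailPerm {n : ℕ} (σ : Equiv.Perm (Fin (n + 1))) (i : Fin n) :
    (σ 0).succAbove (tailPerm σ i) = σ i.succ := by
  have h : σ i.succ ≠ σ 0 := fun h => Fin.succ_ne_zero i (σ.injective h)
  obtain ⟨j, hj⟩ := Fin.exists_succAbove_eq h
  have h1 : ((finSuccEquiv' 0).symm.trans (σ.trans (finSuccEquiv' (σ 0)))) (some i) = some j := by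
    simp [← hj]
  have h2 := Equiv.removeNone_some _ ⟨j, h1⟩
  rw [h1] at h2
  rw [← hj, tailPerm, Option.some_injective _ h2]

/-- The action of a permutation on `X^{⊗ n}` through the symmetry: the factor in position `i` is
moved to position `σ i`. -/
def permAct (X : D) : (n : ℕ) → Equiv.Perm (Fin n) → (tpow X n ⟶ tpow X n)
  | 0, _ => 𝟙 _
  | n + 1, σ => X ◁ permAct X n (tailPerm σ) ≫ insertAt X n (σ 0)

end TensorPowers

section SymmetricPowers

variable {C : Type u} [Category.{v} C] [MonoidalCategory C] [SymmetricCategory C] [Preadditive C]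
  [HasCoequalizers C] [HasImages C]
  [∀ X : C, PreservesColimitsOfShape WalkingParallelPair (tensorLeft X)]
  {A : C} [MonObj A] [IsCommMonObj A]

/-- The sum of all `n!` permutations acting on the `n`-th tensor power of `M` over `A`. -/
noncomputable def symmetrizer (M : Mod C A) (n : ℕ) : (tpow M n).X ⟶ (tpow M n).X :=
  ∑ σ : Equiv.Perm (Fin n), (permAct M n σ).hom

/-- (The object of `C` underlying) the symmetric power `Sym^n_A(M)`, the image of the symmetrizer on
the `n`-th tensor power of `M` over `A`. -/
noncomputable def symPow (M : Mod C A) (n : ℕ) : C :=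
  Limits.image (symmetrizer M n)

end SymmetricPowers

end DeligneTensor

/-!
Write `Sym^n` for the symmetrizer of `M^{⊗ n}`, the sum of all permutations; `Sym^n_A(M) = 0` means
that it vanishes (`isZero_symPow_iff`).

Suppose that `B` is a direct summand of `B ⊗_A M`, and let `a : M ⟶ B` be the restriction of the
projection. The power `a^n : M^{⊗ n} ⟶ B` is symmetric, because `B` is commutative, so
`n! a^n = a^n ∘ Sym^n` (`symOp_powMap`). Hence `a^n = 0` if `Sym^n = 0`, as multiplication by `n!`
is injective on morphisms (`ind_torsionFree`). The values of `a` generate the unit ideal, so that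
`a^{n+1} = 0` implies `a^n = 0` (`restrPow_eq_zero_of_succ`), and finally `1 = 0` in `B`.

Conversely let `N` be the dual of `M` and `c : A ⟶ M ⊗ N` the coevaluation. There is a universal
commutative `A`-algebra `B` with linear maps from `M` and `N` whose product sends `c` to `1`. The
image of `c` in `B ⊗_A M` and the linear form on it induced by `M ⟶ B` make `B` a direct summand
(`wordRetract`), and it must be shown that `B` is not zero. Classically `B` is the quotient of
`Sym(M ⊕ N)` by the ideal generated by `c - 1`, whose part of degree zero is the colimit of
`Sym^n(M) ⊗ Sym^n(N)` under multiplication by `c`. Here `B` is constructed without symmetric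
algebras, as the colimit of all bracketed words in `M` and `N`, along all morphisms generated by the
structure of a symmetric monoidal category and by `c` (`wordAlg`). The product is concatenation; it
is associative, unital and commutative because the associator, unitor and symmetry are among the
morphisms of the diagram.

To bound `B` from below, a compatible family of maps is needed from the words to the colimit of the
mixed tensor powers `M^{⊗ n} ⊗ N^{⊗ n}` under multiplication by `c`. In place of a commutative
product on tensor powers, each letter acts by an insertion operator: a new factor is inserted in all
positions, and the results are added (`insertion`). These operators commute (`leftComm_insertion`),
so that a word acts by its letters, and the action is compatible with all morphisms of words
(`compat_word`, `map_wordDesc`). It follows that `1 = 0` in `B` only if `1` dies in the colimit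
(`colimit_ι_eq_zero`); the unit object being compact, this means that some power
`c^n : A ⟶ M^{⊗ n} ⊗ N^{⊗ n}` vanishes (`exists_eltPow_eq_zero`). Contracting `c^n` with `M^{⊗ n}`,
one contraction after the other by the Leibniz rule, gives `n! Sym^n` (`eltPow_delPow`). So
`c^n = 0` implies `Sym^n = 0` (`symOp_eq_zero`).
-/

namespace DeligneTensor

/-! ### Exchanging two factors -/

section LeftComm

variable {D : Type u} [Category.{v} D] [MonoidalCategory D] [SymmetricCategory D]

/-- The morphism `X ⊗ (Y ⊗ Z) ⟶ Y ⊗ (X ⊗ Z)` that exchanges the first two factors. -/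
def leftComm (X Y Z : D) : X ⊗ (Y ⊗ Z) ⟶ Y ⊗ (X ⊗ Z) :=
  (α_ X Y Z).inv ≫ (β_ X Y).hom ▷ Z ≫ (α_ Y X Z).hom

lemma leftComm_leftComm (X Y Z : D) : leftComm X Y Z ≫ leftComm Y X Z = 𝟙 _ := by
  simp only [leftComm, Category.assoc, Iso.hom_inv_id_assoc]
  rw [← comp_whiskerRight_assoc, SymmetricCategory.symmetry]
  simp

lemma leftComm_naturality (X Y : D) {Z Z' : D} (f : Z ⟶ Z') :
    X ◁ Y ◁ f ≫ leftComm X Y Z' = leftComm X Y Z ≫ Y ◁ X ◁ f := by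
  simp only [leftComm, Category.assoc]
  rw [← associator_naturality_right, ← whisker_exchange_assoc,
    associator_inv_naturality_right_assoc]

lemma leftComm_naturality_left {X X' : D} (f : X ⟶ X') (Y Z : D) :
    f ▷ (Y ⊗ Z) ≫ leftComm X' Y Z = leftComm X Y Z ≫ Y ◁ f ▷ Z := by
  simp only [leftComm, Category.assoc]
  rw [← associator_naturality_middle, associator_inv_naturality_left_assoc,
    ← comp_whiskerRight_assoc, ← comp_whiskerRight_assoc, BraidedCategory.braiding_naturality_left]

lemma leftComm_naturality_middle (X : D) {Y Y' : D} (f : Y ⟶ Y') (Z : D) :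
    X ◁ f ▷ Z ≫ leftComm X Y' Z = leftComm X Y Z ≫ f ▷ (X ⊗ Z) := by
  simp only [leftComm, Category.assoc]
  rw [← associator_naturality_left, associator_inv_naturality_middle_assoc,
    ← comp_whiskerRight_assoc, ← comp_whiskerRight_assoc, BraidedCategory.braiding_naturality_right]

/-- Moving `X` past `Y ⊗ Z` is moving it past `Y` and then past `Z`. -/
lemma leftComm_tensor (X Y Z W : D) :
    leftComm X (Y ⊗ Z) W ≫ (α_ Y Z (X ⊗ W)).hom =
      X ◁ (α_ Y Z W).hom ≫ leftComm X Y (Z ⊗ W) ≫ Y ◁ leftComm X Z W := by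
  simp only [leftComm, BraidedCategory.braiding_tensor_right_hom]
  monoidal

lemma leftComm_tensor_left (X Y Z W : D) :
    (α_ X Y (Z ⊗ W)).hom ≫ X ◁ leftComm Y Z W ≫ leftComm X Z (Y ⊗ W) =
      leftComm (X ⊗ Y) Z W ≫ Z ◁ (α_ X Y W).hom := by
  simp only [leftComm, BraidedCategory.braiding_tensor_left_hom]
  monoidal

lemma leftComm_unit (X Z : D) : leftComm X (𝟙_ D) Z ≫ (λ_ (X ⊗ Z)).hom = X ◁ (λ_ Z).hom := by
  simp only [leftComm, braiding_tensorUnit_right]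
  monoidal

lemma leftComm_unit_left (X Z : D) : leftComm (𝟙_ D) X Z ≫ X ◁ (λ_ Z).hom = (λ_ (X ⊗ Z)).hom := by
  simp only [leftComm, braiding_tensorUnit_left]
  monoidal

/-- The braid relation for three factors in front of `W`. -/
lemma leftComm_braid (X Y Z W : D) :
    leftComm X Y (Z ⊗ W) ≫ Y ◁ leftComm X Z W ≫ leftComm Y Z (X ⊗ W) =
      X ◁ leftComm Y Z W ≫ leftComm X Z (Y ⊗ W) ≫ Z ◁ leftComm X Y W := by
  have h : X ◁ leftComm Y Z W = X ◁ (α_ Y Z W).inv ≫ X ◁ (β_ Y Z).hom ▷ W ≫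
      X ◁ (α_ Z Y W).hom := by simp [leftComm]
  rw [h, Category.assoc, Category.assoc, ← leftComm_tensor, reassoc_of% @leftComm_naturality_middle,
    ← cancel_epi (X ◁ (α_ Y Z W).hom), ← reassoc_of% @leftComm_tensor]
  simp [leftComm]

end LeftComm

/-! ### Insertion operators on tensor powers -/

section Insertion

variable {D : Type u} [Category.{v} D] [MonoidalCategory D] [SymmetricCategory D]
  [Preadditive D] [MonoidalPreadditive D]

/-- From an operator `J` that inserts a factor `M` into `P`, the operator that inserts a factor into
`M ⊗ P`: either in front, or behind the first factor by means of `J`. -/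
def insertStep {M P : D} (J : M ⊗ P ⟶ M ⊗ P) : M ⊗ (M ⊗ P) ⟶ M ⊗ (M ⊗ P) :=
  𝟙 _ + leftComm M M P ≫ M ◁ J

/-- The sum over all positions `0, …, n` of the insertions of a new factor into `M^{⊗ n}`. -/
def insertion (M : D) : (n : ℕ) → (M ⊗ tpow M n ⟶ M ⊗ tpow M n)
  | 0 => 𝟙 _
  | n + 1 => insertStep (insertion M n)

/-- The sum of all permutations of `M^{⊗ n}`, built by inserting one factor after the other. -/
def symOp (M : D) : (n : ℕ) → (tpow M n ⟶ tpow M n)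
  | 0 => 𝟙 _
  | n + 1 => M ◁ symOp M n ≫ insertion M n

lemma insertion_eq_sum (M : D) (n : ℕ) :
    insertion M n = ∑ i : Fin (n + 1), insertAt M n i := by
  induction n with
  | zero => simp [insertion, insertAt]
  | succ n ih =>
    rw [Fin.sum_univ_succ, insertion, insertStep, ih, whiskerLeft_sum, Preadditive.comp_sum]
    rfl

lemma symOp_eq_sum (M : D) (n : ℕ) : symOp M n = ∑ σ : Equiv.Perm (Fin n), permAct M n σ := by
  induction n with
  | zero => simp [symOp, permAct]
  | succ n ih =>
    -- A permutation is determined by the image of `0` and by what it does on the other positions.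
    let e : Equiv.Perm (Fin (n + 1)) → Fin (n + 1) × Equiv.Perm (Fin n) :=
      fun σ => (σ 0, tailPerm σ)
    have hinj : Function.Injective e := by
      intro σ τ h
      obtain ⟨h0, ht⟩ := Prod.ext_iff.1 h
      ext i : 1
      refine Fin.cases h0 (fun i => ?_) i
      rw [← succAbove_tailPerm, ← succAbove_tailPerm τ]
      exact congrArg₂ (fun (a : Fin (n + 1)) (b : Equiv.Perm (Fin n)) => a.succAbove (b i)) h0 ht
    have hbij : Function.Bijective e := by
      rw [Fintype.bijective_iff_injective_and_card]
      refine ⟨hinj, ?_⟩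
      simp [Fintype.card_perm, Nat.factorial_succ]
    change (M ◁ symOp M n ≫ insertion M n : M ⊗ tpow M n ⟶ M ⊗ tpow M n) =
      ∑ σ : Equiv.Perm (Fin (n + 1)), M ◁ permAct M n (tailPerm σ) ≫ insertAt M n (σ 0)
    rw [ih, insertion_eq_sum, whiskerLeft_sum, Preadditive.sum_comp]
    simp only [Preadditive.comp_sum]
    rw [← Fintype.sum_prod_type' (f := fun (τ : Equiv.Perm (Fin n)) (i : Fin (n + 1)) =>
      M ◁ permAct M n τ ≫ insertAt M n i), ← (Equiv.prodComm _ _).sum_comp]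
    exact (hbij.sum_comp (fun p => M ◁ permAct M n p.2 ≫ insertAt M n p.1)).symm

/-- If the insertions into `M ⊗ P` and into `P` commute, then so do those into `M ⊗ (M ⊗ P)` and
into `M ⊗ P`. -/
lemma insertStep_comm {M P : D} (J : M ⊗ P ⟶ M ⊗ P)
    (h : leftComm M M P ≫ M ◁ J ≫ insertStep J = M ◁ J ≫ insertStep J) :
    leftComm M M (M ⊗ P) ≫ M ◁ insertStep J ≫ insertStep (insertStep J) =
      M ◁ insertStep J ≫ insertStep (insertStep J) := by
  have h' := congrArg (M ◁ ·) h
  have br := leftComm_braid M M M P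
  have nat := leftComm_naturality M M J
  simp only [insertStep, Preadditive.comp_add, Preadditive.add_comp, Category.comp_id,
    Category.id_comp, Category.assoc, MonoidalPreadditive.whiskerLeft_add,
    MonoidalCategory.whiskerLeft_comp, MonoidalCategory.whiskerLeft_id,
    reassoc_of% @leftComm_leftComm, leftComm_leftComm] at h' ⊢
  rw [reassoc_of% nat, nat, reassoc_of% br, reassoc_of% br]
  have h'' := congrArg (fun t => M ◁ leftComm M M P ≫ leftComm M M (M ⊗ P) ≫ t) h'
  simp only [Preadditive.comp_add] at h''
  rw [← sub_eq_zero] at h'' ⊢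
  rw [← h'']
  abel

/-- Insertions commute: two new factors may be inserted in either order. -/
lemma leftComm_insertion (M : D) (n : ℕ) :
    leftComm M M (tpow M n) ≫ M ◁ insertion M n ≫ insertStep (insertion M n) =
      M ◁ insertion M n ≫ insertStep (insertion M n) := by
  induction n with
  | zero =>
    simp only [insertion, insertStep, MonoidalCategory.whiskerLeft_id, Category.comp_id,
      Category.id_comp, Preadditive.comp_add]
    rw [leftComm_leftComm, add_comm]
  | succ n ih => exact insertStep_comm _ ih

end Insertion

/-! ### Insertion operators on mixed tensor powers -/

section Fock

variable {D : Type u} [Category.{v} D] [MonoidalCategory D] [SymmetricCategory D]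

/-- The operator on `P ⊗ Q` given by an operator `f : X ⊗ P ⟶ P'` on the first factor. -/
def onFst {X P P' : D} (f : X ⊗ P ⟶ P') (Q : D) : X ⊗ (P ⊗ Q) ⟶ P' ⊗ Q :=
  (α_ X P Q).inv ≫ f ▷ Q

/-- The operator on `P ⊗ Q` given by an operator `g : X ⊗ Q ⟶ Q'` on the second factor. -/
def onSnd (P : D) {X Q Q' : D} (g : X ⊗ Q ⟶ Q') : X ⊗ (P ⊗ Q) ⟶ P ⊗ Q' :=
  leftComm X P Q ≫ P ◁ g

lemma onFst_onFst {X Y P P' P'' : D} (f : X ⊗ P ⟶ P') (g : Y ⊗ P' ⟶ P'') (Q : D) :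
    Y ◁ onFst f Q ≫ onFst g Q = Y ◁ (α_ X P Q).inv ≫ onFst (Y ◁ f ≫ g) Q := by
  simp [onFst]

lemma leftComm_onFst (X Y P Q : D) {P' : D} (h : Y ⊗ (X ⊗ P) ⟶ P') :
    leftComm X Y (P ⊗ Q) ≫ Y ◁ (α_ X P Q).inv ≫ onFst h Q =
      X ◁ (α_ Y P Q).inv ≫ onFst (leftComm X Y P ≫ h) Q := by
  simp only [onFst, leftComm, comp_whiskerRight, Category.assoc]
  monoidal

lemma onSnd_onSnd (P : D) {X Y Q Q' Q'' : D} (f : X ⊗ Q ⟶ Q') (g : Y ⊗ Q' ⟶ Q'') :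
    Y ◁ onSnd P f ≫ onSnd P g =
      Y ◁ leftComm X P Q ≫ leftComm Y P (X ⊗ Q) ≫ P ◁ (Y ◁ f ≫ g) := by
  simp only [onSnd, MonoidalCategory.whiskerLeft_comp, Category.assoc]
  rw [reassoc_of% @leftComm_naturality]

lemma leftComm_onSnd (P X Y Q : D) {Q' : D} (h : Y ⊗ (X ⊗ Q) ⟶ Q') :
    leftComm X Y (P ⊗ Q) ≫ Y ◁ leftComm X P Q ≫ leftComm Y P (X ⊗ Q) ≫ P ◁ h =
      X ◁ leftComm Y P Q ≫ leftComm X P (Y ⊗ Q) ≫ P ◁ (leftComm X Y Q ≫ h) := by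
  have := leftComm_braid X Y P Q
  rw [reassoc_of% this, MonoidalCategory.whiskerLeft_comp]

/-- Operators on different factors commute. -/
lemma onSnd_onFst {X Y P P' Q Q' : D} (f : X ⊗ P ⟶ P') (g : Y ⊗ Q ⟶ Q') :
    X ◁ onSnd P g ≫ onFst f Q' = leftComm X Y (P ⊗ Q) ≫ Y ◁ onFst f Q ≫ onSnd P' g := by
  have h : leftComm X Y (P ⊗ Q) ≫ Y ◁ (α_ X P Q).inv ≫ leftComm Y (X ⊗ P) Q =
      X ◁ leftComm Y P Q ≫ (α_ X P (Y ⊗ Q)).inv := by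
    rw [← cancel_mono (α_ X P (Y ⊗ Q)).hom]
    simp only [Category.assoc, leftComm_tensor, Iso.inv_hom_id, Category.comp_id]
    rw [← MonoidalCategory.whiskerLeft_comp_assoc, Iso.inv_hom_id,
      MonoidalCategory.whiskerLeft_id, Category.id_comp, reassoc_of% @leftComm_leftComm]
  simp only [onFst, onSnd, MonoidalCategory.whiskerLeft_comp, Category.assoc]
  rw [reassoc_of% @leftComm_naturality_middle, reassoc_of% h, ← whisker_exchange,
    associator_inv_naturality_right_assoc]

/-- The operator `X ⊗ (Y ⊗ Z) ⟶ Z` that contracts the first two factors by `e`. -/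
def contract {X Y : D} (e : X ⊗ Y ⟶ 𝟙_ D) (Z : D) : X ⊗ (Y ⊗ Z) ⟶ Z :=
  (α_ X Y Z).inv ≫ e ▷ Z ≫ (λ_ Z).hom

lemma contract_naturality {X Y : D} (e : X ⊗ Y ⟶ 𝟙_ D) {Z Z' : D} (f : Z ⟶ Z') :
    X ◁ Y ◁ f ≫ contract e Z' = contract e Z ≫ f := by
  simp only [contract, Category.assoc]
  rw [associator_inv_naturality_right_assoc, whisker_exchange_assoc, leftUnitor_naturality]

lemma leftComm_contract {X Y : D} (e : X ⊗ Y ⟶ 𝟙_ D) (P Z : D) :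
    X ◁ leftComm Y P Z ≫ leftComm X P (Y ⊗ Z) ≫ P ◁ contract e Z = contract e (P ⊗ Z) := by
  have h := leftComm_tensor_left X Y P Z
  simp only [contract, MonoidalCategory.whiskerLeft_comp]
  rw [← cancel_epi (α_ X Y (P ⊗ Z)).hom, reassoc_of% h]
  rw [← MonoidalCategory.whiskerLeft_comp_assoc, Iso.hom_inv_id, MonoidalCategory.whiskerLeft_id,
    Category.id_comp, ← reassoc_of% @leftComm_naturality_left, leftComm_unit_left]
  simp

/-- The morphism `W ⟶ Y ⊗ (Z ⊗ W)` that creates two factors by `c`. -/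
def create {Y Z : D} (c : 𝟙_ D ⟶ Y ⊗ Z) (W : D) : W ⟶ Y ⊗ (Z ⊗ W) :=
  (λ_ W).inv ≫ c ▷ W ≫ (α_ Y Z W).hom

lemma create_naturality {Y Z : D} (c : 𝟙_ D ⟶ Y ⊗ Z) {W W' : D} (f : W ⟶ W') :
    f ≫ create c W' = create c W ≫ Y ◁ Z ◁ f := by
  simp only [create, Category.assoc]
  rw [leftUnitor_inv_naturality_assoc, whisker_exchange_assoc, associator_naturality_right]

/-- Moving `X` past the pair of factors created by `c`. -/
lemma create_leftComm {Y Z : D} (c : 𝟙_ D ⟶ Y ⊗ Z) (X W : D) :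
    X ◁ create c W ≫ leftComm X Y (Z ⊗ W) ≫ Y ◁ leftComm X Z W = create c (X ⊗ W) := by
  have h : X ◁ (λ_ W).inv ≫ leftComm X (𝟙_ D) W = (λ_ (X ⊗ W)).inv := by
    rw [← cancel_mono (λ_ (X ⊗ W)).hom, Category.assoc, leftComm_unit]
    simp
  simp only [create, MonoidalCategory.whiskerLeft_comp, Category.assoc]
  rw [← leftComm_tensor, reassoc_of% @leftComm_naturality_middle, reassoc_of% h]

/-- The triangle identity for a right dual, with the factors rearranged by the symmetry. -/
lemma create_contract (M N : D) [ExactPairing M N] (Z : D) :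
    M ◁ create (η_ M N) Z ≫ leftComm M M (N ⊗ Z) ≫ M ◁ contract ((β_ M N).hom ≫ ε_ M N) Z =
      𝟙 (M ⊗ Z) := by
  have h : M ◁ contract ((β_ M N).hom ≫ ε_ M N) Z =
      M ◁ leftComm M N Z ≫ M ◁ contract (ε_ M N) Z := by
    rw [← MonoidalCategory.whiskerLeft_comp]
    simp [contract, leftComm]
  rw [h, reassoc_of% @create_leftComm]
  have t := ExactPairing.evaluation_coevaluation M N
  calc _ = (λ_ (M ⊗ Z)).inv ≫ (α_ _ _ _).inv ≫ ((η_ M N ▷ M ≫ (α_ M N M).hom ≫ M ◁ ε_ M N) ▷ Z) ≫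
      (ρ_ M).hom ▷ Z := by simp only [create, contract]; monoidal
    _ = _ := by rw [t]; monoidal

variable [Preadditive D] [MonoidalPreadditive D]

/-- The mixed tensor power `M^{⊗ p} ⊗ N^{⊗ q}`. -/
abbrev mixed (M N : D) (p q : ℕ) : D := tpow M p ⊗ tpow N q

/-- Insertion of a factor `M` into `M^{⊗ p} ⊗ N^{⊗ q}`, summed over all positions in `M^{⊗ p}`. -/
def insFst (M N : D) (p q : ℕ) : M ⊗ mixed M N p q ⟶ mixed M N (p + 1) q :=
  onFst (insertion M p) (tpow N q)

/-- Insertion of a factor `N` into `M^{⊗ p} ⊗ N^{⊗ q}`, summed over all positions in `N^{⊗ q}`. -/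
def insSnd (M N : D) (p q : ℕ) : N ⊗ mixed M N p q ⟶ mixed M N p (q + 1) :=
  onSnd (tpow M p) (insertion N q)

lemma insFst_insFst (M N : D) (p q : ℕ) :
    leftComm M M (mixed M N p q) ≫ M ◁ insFst M N p q ≫ insFst M N (p + 1) q =
      M ◁ insFst M N p q ≫ insFst M N (p + 1) q := by
  have h := onFst_onFst (insertion M p) (insertStep (insertion M p)) (tpow N q)
  have h' := leftComm_onFst M M (tpow M p) (tpow N q) (M ◁ insertion M p ≫
    insertStep (insertion M p))
  rw [leftComm_insertion, ← h] at h'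
  exact h'

lemma insSnd_insSnd (M N : D) (p q : ℕ) :
    leftComm N N (mixed M N p q) ≫ N ◁ insSnd M N p q ≫ insSnd M N p (q + 1) =
      N ◁ insSnd M N p q ≫ insSnd M N p (q + 1) := by
  have h := onSnd_onSnd (tpow M p) (insertion N q) (insertStep (insertion N q))
  have h' := leftComm_onSnd (tpow M p) N N (tpow N q) (N ◁ insertion N q ≫
    insertStep (insertion N q))
  rw [leftComm_insertion, ← h] at h'
  exact h'

lemma insSnd_insFst (M N : D) (p q : ℕ) :
    M ◁ insSnd M N p q ≫ insFst M N p (q + 1) =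
      leftComm M N (mixed M N p q) ≫ N ◁ insFst M N p q ≫ insSnd M N (p + 1) q :=
  onSnd_onFst (insertion M p) (insertion N q)

lemma insFst_insSnd (M N : D) (p q : ℕ) :
    N ◁ insFst M N p q ≫ insSnd M N (p + 1) q =
      leftComm N M (mixed M N p q) ≫ M ◁ insSnd M N p q ≫ insFst M N p (q + 1) := by
  rw [insSnd_insFst, reassoc_of% @leftComm_leftComm]

/-- An operator that commutes with two operators commutes with their composite after `create`. -/
lemma create_comm {M N : D} (c : 𝟙_ D ⟶ M ⊗ N) {X Z Z₁ Z₂ Z' Z₁' Z₂' : D}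
    {b : N ⊗ Z ⟶ Z₁} {a : M ⊗ Z₁ ⟶ Z₂} {b' : N ⊗ Z' ⟶ Z₁'} {a' : M ⊗ Z₁' ⟶ Z₂'}
    {x : X ⊗ Z ⟶ Z'} {x₁ : X ⊗ Z₁ ⟶ Z₁'} {x₂ : X ⊗ Z₂ ⟶ Z₂'}
    (hb : X ◁ b ≫ x₁ = leftComm X N Z ≫ N ◁ x ≫ b')
    (ha : X ◁ a ≫ x₂ = leftComm X M Z₁ ≫ M ◁ x₁ ≫ a') :
    X ◁ (create c Z ≫ M ◁ b ≫ a) ≫ x₂ = x ≫ create c Z' ≫ M ◁ b' ≫ a' := by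
  rw [reassoc_of% @create_naturality, ← reassoc_of% @create_leftComm]
  simp only [MonoidalCategory.whiskerLeft_comp, Category.assoc]
  rw [ha, reassoc_of% @leftComm_naturality, ← MonoidalCategory.whiskerLeft_comp_assoc, hb]
  simp only [MonoidalCategory.whiskerLeft_comp, Category.assoc]

variable {M N : D} (c : 𝟙_ D ⟶ M ⊗ N)

/-- Multiplication by the element `c` of `M ⊗ N`: its two factors are created and then inserted. -/
def mulElt (p q : ℕ) : mixed M N p q ⟶ mixed M N (p + 1) (q + 1) :=
  create c (mixed M N p q) ≫ M ◁ insSnd M N p q ≫ insFst M N p (q + 1)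

lemma mulElt_insFst (p q : ℕ) :
    M ◁ mulElt c p q ≫ insFst M N (p + 1) (q + 1) = insFst M N p q ≫ mulElt c (p + 1) q :=
  create_comm c (insSnd_insFst M N p q) (insFst_insFst M N p (q + 1)).symm

lemma mulElt_insSnd (p q : ℕ) :
    N ◁ mulElt c p q ≫ insSnd M N (p + 1) (q + 1) = insSnd M N p q ≫ mulElt c p (q + 1) :=
  create_comm c (insSnd_insSnd M N p q).symm (insFst_insSnd M N p (q + 1))

end Fock

/-! ### Contraction of the powers of the coevaluation -/

section Contraction

variable {D : Type u} [Category.{v} D] [MonoidalCategory D] [SymmetricCategory D]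
  [Preadditive D] [MonoidalPreadditive D] (M N : D) [ExactPairing M N]

/-- Contraction of a factor `M` with the first of the factors `N` of `M^{⊗ p} ⊗ N^{⊗ (q + 1)}`. -/
def del (p q : ℕ) : M ⊗ mixed M N p (q + 1) ⟶ mixed M N p q :=
  onSnd (tpow M p) (contract ((β_ M N).hom ≫ ε_ M N) (tpow N q))

lemma insFst_del (p q : ℕ) : M ◁ insFst M N p (q + 1) ≫ del M N (p + 1) q =
    leftComm M M (mixed M N p (q + 1)) ≫ M ◁ del M N p q ≫ insFst M N p q := by
  have h := onSnd_onFst (insertion M p) (contract ((β_ M N).hom ≫ ε_ M N) (tpow N q))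
  have h' := congrArg (fun t => leftComm M M (mixed M N p (q + 1)) ≫ t) h
  exact (h'.trans ((reassoc_of% @leftComm_leftComm) _ _ _ _)).symm

/-- The Leibniz rule for the contraction of an inserted factor `N`. -/
lemma insSnd_del (p q : ℕ) : M ◁ insSnd M N p (q + 1) ≫ del M N p (q + 1) =
    contract ((β_ M N).hom ≫ ε_ M N) (mixed M N p (q + 1)) +
      leftComm M N (mixed M N p (q + 1)) ≫ N ◁ del M N p q ≫ insSnd M N p q := by
  have h := onSnd_onSnd (tpow M p) (insertStep (insertion N q))
    (contract ((β_ M N).hom ≫ ε_ M N) (N ⊗ tpow N q))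
  have h1 := onSnd_onSnd (tpow M p) (contract ((β_ M N).hom ≫ ε_ M N) (tpow N q)) (insertion N q)
  have h2 := leftComm_onSnd (tpow M p) M N (N ⊗ tpow N q)
    (N ◁ contract ((β_ M N).hom ≫ ε_ M N) (tpow N q) ≫ insertion N q)
  have h3 : M ◁ insertStep (insertion N q) ≫ contract ((β_ M N).hom ≫ ε_ M N) (N ⊗ tpow N q) =
      contract ((β_ M N).hom ≫ ε_ M N) (N ⊗ tpow N q) +
        leftComm M N (N ⊗ tpow N q) ≫ N ◁ contract ((β_ M N).hom ≫ ε_ M N) (tpow N q) ≫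
          insertion N q := by
    rw [insertStep, MonoidalPreadditive.whiskerLeft_add, Preadditive.add_comp,
      MonoidalCategory.whiskerLeft_id, Category.id_comp, MonoidalCategory.whiskerLeft_comp,
      Category.assoc, contract_naturality, ← reassoc_of% @leftComm_contract,
      ← MonoidalCategory.whiskerLeft_comp_assoc, leftComm_leftComm,
      MonoidalCategory.whiskerLeft_id, Category.id_comp]
  rw [h3, MonoidalPreadditive.whiskerLeft_add, Preadditive.comp_add, Preadditive.comp_add,
    leftComm_contract, ← h2, ← h1] at h
  exact h

lemma insSnd_del_zero (p : ℕ) : M ◁ insSnd M N p 0 ≫ del M N p 0 =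
    contract ((β_ M N).hom ≫ ε_ M N) (mixed M N p 0) := by
  have h := onSnd_onSnd (tpow M p) (𝟙 (N ⊗ tpow N 0))
    (contract ((β_ M N).hom ≫ ε_ M N) (tpow N 0))
  rw [MonoidalCategory.whiskerLeft_id, Category.id_comp, leftComm_contract] at h
  exact h

variable {M N} in
/-- The Leibniz rule behind `mulElt_del`: a contraction `M ⊗ - ⟶ -` that commutes with `a` and has
commutator the evaluation with `b` sends the composite of `b` and `a` after the coevaluation
to `a`, up to a term in which the contraction acts first. -/
lemma create_leibniz {Z Z₁ Z₂ Z' : D} {b : N ⊗ Z ⟶ Z₁} {a : M ⊗ Z₁ ⟶ Z₂} {d₁ : M ⊗ Z₁ ⟶ Z}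
    {d₂ : M ⊗ Z₂ ⟶ Z'} {a' : M ⊗ Z ⟶ Z'} (y : M ⊗ (N ⊗ Z) ⟶ Z)
    (ha : M ◁ a ≫ d₂ = leftComm M M Z₁ ≫ M ◁ d₁ ≫ a')
    (hb : M ◁ b ≫ d₁ = contract ((β_ M N).hom ≫ ε_ M N) Z + y) :
    M ◁ (create (η_ M N) Z ≫ M ◁ b ≫ a) ≫ d₂ =
      a' + M ◁ create (η_ M N) Z ≫ leftComm M M (N ⊗ Z) ≫ M ◁ y ≫ a' := by
  simp only [MonoidalCategory.whiskerLeft_comp, Category.assoc]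
  rw [ha, reassoc_of% @leftComm_naturality, ← MonoidalCategory.whiskerLeft_comp_assoc, hb,
    MonoidalPreadditive.whiskerLeft_add, Preadditive.add_comp, Preadditive.comp_add,
    Preadditive.comp_add]
  have h := create_contract M N Z
  rw [reassoc_of% h]

/-- The Leibniz rule: contracting by `m` after multiplying by the coevaluation either meets the new
factor `N`, which inserts `m`, or acts first. -/
lemma mulElt_del (p q : ℕ) :
    M ◁ mulElt (η_ M N) p (q + 1) ≫ del M N (p + 1) (q + 1) =
      insFst M N p (q + 1) + del M N p q ≫ mulElt (η_ M N) p q := by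
  refine (create_leibniz _ (insFst_del M N p (q + 1)) (insSnd_del M N p q)).trans ?_
  congr 1
  rw [MonoidalCategory.whiskerLeft_comp_assoc, reassoc_of% @create_leftComm,
    MonoidalCategory.whiskerLeft_comp_assoc, mulElt, reassoc_of% @create_naturality]

lemma mulElt_del_zero (p : ℕ) :
    M ◁ mulElt (η_ M N) p 0 ≫ del M N (p + 1) 0 = insFst M N p 0 := by
  refine (create_leibniz 0 (insFst_del M N p 0)
    ((insSnd_del_zero M N p).trans (add_zero _).symm)).trans ?_
  simp

/-- The `n`-th power of the coevaluation, as a morphism into `M^{⊗ n} ⊗ N^{⊗ n}`. -/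
def eltPow : (n : ℕ) → (mixed M N 0 0 ⟶ mixed M N n n)
  | 0 => 𝟙 _
  | n + 1 => eltPow n ≫ mulElt (η_ M N) n n

/-- From contractions `d` by `M` and `r` by `T`, the contraction by `M ⊗ T` in which `d` acts
first. -/
def delStep {M T Z Z' W : D} (d : M ⊗ Z ⟶ Z') (r : T ⊗ Z' ⟶ W) : (M ⊗ T) ⊗ Z ⟶ W :=
  (α_ M T Z).hom ≫ leftComm M T Z ≫ T ◁ d ≫ r

lemma delStep_comm {X M T Z Z' W Z₁ Z₁' W₁ : D} {d : M ⊗ Z ⟶ Z'} {r : T ⊗ Z' ⟶ W}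
    {d₁ : M ⊗ Z₁ ⟶ Z₁'} {r₁ : T ⊗ Z₁' ⟶ W₁} {x : X ⊗ Z ⟶ Z₁} {x' : X ⊗ Z' ⟶ Z₁'}
    {y : X ⊗ W ⟶ W₁} (h : M ◁ x ≫ d₁ = leftComm M X Z ≫ X ◁ d ≫ x')
    (hr : leftComm X T Z' ≫ T ◁ x' ≫ r₁ = X ◁ r ≫ y) :
    leftComm X (M ⊗ T) Z ≫ (M ⊗ T) ◁ x ≫ delStep d₁ r₁ = X ◁ delStep d r ≫ y := by
  have h1 := leftComm_tensor X M T Z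
  have h2 := leftComm_braid X M T Z
  simp only [delStep, tensor_whiskerLeft, Category.assoc, Iso.inv_hom_id_assoc]
  rw [reassoc_of% h1, reassoc_of% @leftComm_naturality,
    ← MonoidalCategory.whiskerLeft_comp_assoc T (M ◁ _), h]
  simp only [MonoidalCategory.whiskerLeft_comp, Category.assoc]
  rw [reassoc_of% h2, ← MonoidalCategory.whiskerLeft_comp_assoc T (leftComm _ _ _),
    leftComm_leftComm, MonoidalCategory.whiskerLeft_id, Category.id_comp,
    ← reassoc_of% @leftComm_naturality, hr]

lemma whiskerLeft_delStep {M T Y Z Z' W : D} (f : Y ⟶ Z) (d : M ⊗ Z ⟶ Z') (r : T ⊗ Z' ⟶ W) :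
    (M ⊗ T) ◁ f ≫ delStep d r = (α_ M T Y).hom ≫ leftComm M T Y ≫ T ◁ (M ◁ f ≫ d) ≫ r := by
  simp only [delStep, tensor_whiskerLeft, Category.assoc, Iso.inv_hom_id_assoc]
  rw [reassoc_of% @leftComm_naturality, ← MonoidalCategory.whiskerLeft_comp_assoc]

/-- Contraction of `M^{⊗ k}` with all the factors `N` of `M^{⊗ p} ⊗ N^{⊗ k}`. -/
def delPow (p : ℕ) : (k : ℕ) → (tpow M k ⊗ mixed M N p k ⟶ mixed M N p 0)
  | 0 => (λ_ _).hom
  | k + 1 => delStep (del M N p k) (delPow p k)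

lemma whiskerLeft_nsmul (X : D) {Y Z : D} (f : Y ⟶ Z) (n : ℕ) : X ◁ (n • f) = n • (X ◁ f) :=
  (tensorLeft X).map_nsmul

/-- The contraction by `M` acts on powers of the coevaluation as a derivation. -/
lemma eltPow_del (n : ℕ) : M ◁ eltPow M N (n + 1) ≫ del M N (n + 1) n =
    (n + 1) • (M ◁ eltPow M N n ≫ insFst M N n n) := by
  induction n with
  | zero =>
    simp [eltPow, mulElt_del_zero]
  | succ n ih =>
    rw [eltPow, MonoidalCategory.whiskerLeft_comp, Category.assoc, mulElt_del,
      Preadditive.comp_add, reassoc_of% ih, Preadditive.nsmul_comp, Category.assoc,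
      ← mulElt_insFst, ← MonoidalCategory.whiskerLeft_comp_assoc]
    exact (succ_nsmul' (M ◁ eltPow M N (n + 1) ≫ insFst M N (n + 1) (n + 1)) (n + 1)).symm

lemma insFst_delPow (p k : ℕ) :
    leftComm M (tpow M k) (mixed M N p k) ≫ tpow M k ◁ insFst M N p k ≫ delPow M N (p + 1) k =
      M ◁ delPow M N p k ≫ insFst M N p 0 := by
  induction k generalizing p with
  | zero =>
    simp only [delPow]
    erw [leftUnitor_naturality, reassoc_of% @leftComm_unit]
    rfl
  | succ k ih =>
    exact delStep_comm (insFst_del M N p k) (ih p)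

/-- The `n`-fold contraction of the `n`-th power of the coevaluation is `n!` times the sum of all
permutations of `M^{⊗ n}`. -/
lemma eltPow_delPow (n : ℕ) : tpow M n ◁ eltPow M N n ≫ delPow M N n n =
    n.factorial • (symOp M n ▷ (𝟙_ D ⊗ 𝟙_ D) ≫ tpow M n ◁ (λ_ (𝟙_ D)).hom) := by
  induction n with
  | zero =>
    simp only [eltPow, delPow, symOp, MonoidalCategory.whiskerLeft_id, id_whiskerRight,
      Category.id_comp, Nat.factorial_zero, one_smul]
    simp [tpow]
    rfl
  | succ n ih =>
    have h := whiskerLeft_delStep (eltPow M N (n + 1)) (del M N (n + 1) n) (delPow M N (n + 1) n)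
    refine h.trans ?_
    rw [eltPow_del, whiskerLeft_nsmul]
    simp only [Preadditive.nsmul_comp, Preadditive.comp_nsmul, MonoidalCategory.whiskerLeft_comp,
      Category.assoc]
    rw [← reassoc_of% @leftComm_naturality, insFst_delPow,
      ← MonoidalCategory.whiskerLeft_comp_assoc M (_ ◁ _), ih]
    -- The remaining identity is separated from the recursive definition of the tensor powers.
    have h : ∀ {P : D} (s : tpow M n ⟶ P) (t : M ⊗ P ⟶ M ⊗ P) {U V : D} (l : U ⟶ V) (k : ℕ),
        (α_ M (tpow M n) U).hom ≫ M ◁ (k • (s ▷ U ≫ P ◁ l)) ≫ onFst t V =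
          k • ((M ◁ s ≫ t) ▷ U ≫ (M ⊗ P) ◁ l) := by
      intro P s t U V l k
      rw [whiskerLeft_nsmul, Preadditive.nsmul_comp, Preadditive.comp_nsmul]
      congr 1
      simp only [onFst, MonoidalCategory.whiskerLeft_comp, comp_whiskerRight, Category.assoc]
      rw [associator_inv_naturality_right_assoc, whisker_exchange,
        associator_inv_naturality_middle_assoc, Iso.hom_inv_id_assoc]
    refine (congrArg ((n + 1) • ·) (h (symOp M n) (insertion M n) (λ_ (𝟙_ D)).hom
      n.factorial)).trans ?_
    rw [Nat.factorial_succ]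
    exact smul_smul (n + 1) n.factorial ((M ◁ symOp M n ≫ insertion M n) ▷ (𝟙_ D ⊗ 𝟙_ D) ≫
      (M ⊗ tpow M n) ◁ (λ_ (𝟙_ D)).hom)

variable {M N} in
/-- In the absence of `n!`-torsion, the symmetrizer of `M^{⊗ n}` vanishes with the `n`-th power of
the coevaluation. -/
lemma symOp_eq_zero {n : ℕ} (htf : ∀ {X Y : D} (f : X ⟶ Y), n.factorial • f = 0 → f = 0)
    (h : eltPow M N n = 0) : symOp M n = 0 := by
  have h1 := htf _ ((eltPow_delPow M N n).symm.trans (by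
    rw [h, MonoidalPreadditive.whiskerLeft_zero, zero_comp]
    rfl))
  have h2 : symOp M n ▷ 𝟙_ D = 0 := by
    rw [← whisker_exchange] at h1
    exact (cancel_epi (tpow M n ◁ (λ_ (𝟙_ D)).hom)).1 (h1.trans comp_zero.symm)
  rw [← cancel_epi (ρ_ (tpow M n)).hom, ← rightUnitor_naturality, h2, zero_comp, comp_zero]

end Contraction

/-! ### Words in two objects -/

section Words

/-- Binary bracketed words in two letters. -/
inductive Word : Type w
  | unit : Word
  | fst : Word
  | snd : Word
  | tensor (i j : Word) : Word

variable {D : Type u} [Category.{v} D] [MonoidalCategory D] [SymmetricCategory D]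

/-- The value of a word when the letters are `M` and `N`. -/
def Word.eval (M N : D) : Word.{w} → D
  | .unit => 𝟙_ D
  | .fst => M
  | .snd => N
  | .tensor i j => i.eval M N ⊗ j.eval M N

variable {M N : D} (c : 𝟙_ D ⟶ M ⊗ N)

/-- The morphisms between the values of words that are generated, under composition and whiskering,
by the structural morphisms of the symmetric monoidal category and by `c`. -/
inductive WordHom : (i j : Word.{w}) → (i.eval M N ⟶ j.eval M N) → Prop
  | id (i) : WordHom i i (𝟙 _)
  | comp {i j k f g} : WordHom i j f → WordHom j k g → WordHom i k (f ≫ g)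
  | whiskerLeft (k) {i j f} : WordHom i j f → WordHom (.tensor k i) (.tensor k j) (_ ◁ f)
  | whiskerRight {i j f} (k) : WordHom i j f → WordHom (.tensor i k) (.tensor j k) (f ▷ _)
  | associator (i j k) : WordHom (.tensor (.tensor i j) k) (.tensor i (.tensor j k)) (α_ _ _ _).hom
  | leftUnitor (i) : WordHom (.tensor .unit i) i (λ_ _).hom
  | braiding (i j) : WordHom (.tensor i j) (.tensor j i) (β_ _ _).hom
  | create : WordHom .unit (.tensor .fst .snd) c

/-- The category of words, with the morphisms of `WordHom`. The objects do not depend on `c`, which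
is a parameter of the type so that the morphisms can be found from it. -/
@[nolint unusedArguments]
def WordCat (_ : 𝟙_ D ⟶ M ⊗ N) : Type w := Word.{w}

instance : Category.{v} (WordCat.{v, u, w} c) where
  Hom i j := { f : Word.eval M N i ⟶ Word.eval M N j // WordHom c i j f }
  id i := ⟨𝟙 _, .id i⟩
  comp f g := ⟨f.1 ≫ g.1, .comp f.2 g.2⟩

/-- The faithful functor from the category of words to `D` that evaluates words. -/
def wordFunctor : WordCat.{v, u, w} c ⥤ D where
  obj i := Word.eval M N i
  map f := f.1

/-- A family of operators `T W → T (X ⊗ W)`, natural in `W`, on a presheaf `T`. -/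
structure PshOp (T : Dᵒᵖ ⥤ Type w) (X : D) where
  /-- The operators. -/
  app (W : D) : T.obj (op W) → T.obj (op (X ⊗ W))
  naturality {W' W : D} (f : W' ⟶ W) (t : T.obj (op W)) :
    app W' (T.map f.op t) = T.map (X ◁ f).op (app W t)

namespace PshOp

variable {T : Dᵒᵖ ⥤ Type w}

/-- Two families of operators commute, up to the exchange of the two factors they create. -/
def Comm {X Y : D} (x : PshOp T X) (y : PshOp T Y) : Prop :=
  ∀ (W : D) (t : T.obj (op W)), T.map (leftComm X Y W).op (y.app _ (x.app W t)) =
    x.app _ (y.app W t)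

lemma map_map {X Y Z : D} (f : X ⟶ Y) (g : Y ⟶ Z) (t : T.obj (op Z)) :
    T.map f.op (T.map g.op t) = T.map (f ≫ g).op t := by
  rw [op_comp, Functor.map_comp_apply]

lemma Comm.symm {X Y : D} {x : PshOp T X} {y : PshOp T Y} (h : x.Comm y) : y.Comm x := by
  intro W t
  rw [← h, map_map, leftComm_leftComm, op_id, Functor.map_id_apply]

variable (T) in
/-- The identity, as a family of operators creating the unit. -/
def unit : PshOp T (𝟙_ D) where
  app W t := T.map (λ_ W).hom.op t
  naturality f t := by rw [map_map, map_map, leftUnitor_naturality]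

/-- The composite of two families of operators. -/
def tensor {X Y : D} (x : PshOp T X) (y : PshOp T Y) : PshOp T (X ⊗ Y) where
  app W t := T.map (α_ X Y W).hom.op (x.app _ (y.app W t))
  naturality f t := by
    rw [y.naturality, x.naturality, map_map, map_map, associator_naturality_right]

lemma comm_unit {X : D} (x : PshOp T X) : x.Comm (unit T) := by
  intro W t
  change T.map _ (T.map (λ_ _).hom.op _) = x.app _ (T.map (λ_ _).hom.op _)
  rw [x.naturality, map_map, leftComm_unit]

lemma Comm.tensor {X Y Z : D} {x : PshOp T X} {y : PshOp T Y} {z : PshOp T Z} (hy : x.Comm y)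
    (hz : x.Comm z) : x.Comm (y.tensor z) := by
  intro W t
  change T.map _ (T.map (α_ _ _ _).hom.op (y.app _ (z.app _ (x.app W t)))) =
    x.app _ (T.map (α_ _ _ _).hom.op (y.app _ (z.app _ t)))
  rw [x.naturality, map_map, leftComm_tensor, ← map_map, ← map_map, ← hy, ← hz, y.naturality]

/-- A morphism `f : X ⟶ Y` carries the operators creating `Y` to those creating `X`. -/
def Compat {X Y : D} (f : X ⟶ Y) (x : PshOp T X) (y : PshOp T Y) : Prop :=
  ∀ (W : D) (t : T.obj (op W)), T.map (f ▷ W).op (y.app W t) = x.app W t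

section Compat

variable {X Y Z : D} {x : PshOp T X} {y : PshOp T Y} {z : PshOp T Z}

lemma Compat.id : Compat (𝟙 X) x x := fun W t => by
  rw [id_whiskerRight, op_id, Functor.map_id_apply]

lemma Compat.comp {f : X ⟶ Y} {g : Y ⟶ Z} (hf : Compat f x y) (hg : Compat g y z) :
    Compat (f ≫ g) x z := fun W t => by
  rw [comp_whiskerRight, ← map_map, hg, hf]

lemma Compat.whiskerLeft (z : PshOp T Z) {f : X ⟶ Y} (hf : Compat f x y) :
    Compat (Z ◁ f) (z.tensor x) (z.tensor y) := fun W t => by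
  change T.map _ (T.map (α_ _ _ _).hom.op _) = T.map (α_ _ _ _).hom.op _
  rw [map_map, associator_naturality_middle, ← map_map, ← PshOp.naturality, hf]

lemma Compat.whiskerRight {f : X ⟶ Y} (hf : Compat f x y) (z : PshOp T Z) :
    Compat (f ▷ Z) (x.tensor z) (y.tensor z) := fun W t => by
  change T.map _ (T.map (α_ _ _ _).hom.op _) = T.map (α_ _ _ _).hom.op _
  rw [map_map, associator_naturality_left, ← map_map, hf]

lemma compat_associator (x : PshOp T X) (y : PshOp T Y) (z : PshOp T Z) :
    Compat (α_ X Y Z).hom ((x.tensor y).tensor z) (x.tensor (y.tensor z)) := fun W t => by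
  change T.map _ (T.map (α_ _ _ _).hom.op (x.app _ (T.map (α_ _ _ _).hom.op _))) =
    T.map (α_ _ _ _).hom.op (T.map (α_ _ _ _).hom.op _)
  rw [PshOp.naturality, map_map, map_map, map_map, Category.assoc, pentagon]

lemma compat_leftUnitor (x : PshOp T X) : Compat (λ_ X).hom ((unit T).tensor x) x := fun W t => by
  change _ = T.map (α_ _ _ _).hom.op (T.map (λ_ _).hom.op _)
  rw [map_map, leftUnitor_tensor_hom, Iso.hom_inv_id_assoc]

lemma Comm.compat_braiding (h : x.Comm y) :
    Compat (β_ X Y).hom (x.tensor y) (y.tensor x) := fun W t => by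
  change T.map _ (T.map (α_ _ _ _).hom.op _) = T.map (α_ _ _ _).hom.op _
  rw [← h, map_map, map_map, leftComm, Iso.hom_inv_id_assoc]

lemma compat_create {c : 𝟙_ D ⟶ X ⊗ Y}
    (hc : ∀ W (t : T.obj (op W)), T.map (create c W).op (x.app _ (y.app W t)) = t) :
    Compat c (unit T) (x.tensor y) := fun W t => by
  change T.map _ (T.map (α_ _ _ _).hom.op (x.app _ (y.app W t))) = T.map (λ_ W).hom.op t
  conv_rhs => rw [← hc W t]
  rw [map_map, map_map, create, Iso.hom_inv_id_assoc]

end Compat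

/-- The operators of a word, from those of its letters. -/
def word (a : PshOp T M) (b : PshOp T N) : (i : Word.{w}) → PshOp T (i.eval M N)
  | .unit => unit T
  | .fst => a
  | .snd => b
  | .tensor i j => (word a b i).tensor (word a b j)

variable {a : PshOp T M} {b : PshOp T N}

lemma comm_word {X : D} {x : PshOp T X} (ha : x.Comm a) (hb : x.Comm b) (i : Word.{w}) :
    x.Comm (word a b i) := by
  induction i with
  | unit => exact x.comm_unit
  | fst => exact ha
  | snd => exact hb
  | tensor i j hi hj => exact hi.tensor hj

lemma word_comm_word (haa : a.Comm a) (hab : a.Comm b) (hbb : b.Comm b) (i j : Word.{w}) :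
    (word a b i).Comm (word a b j) :=
  comm_word (comm_word haa hab i).symm (comm_word hab.symm hbb i).symm j

/-- If the operators `a` and `b` of the letters commute with themselves and with each other, and if
creating two factors by `c` undoes `b` followed by `a`, then the operators of words are compatible
with the morphisms of words. -/
lemma compat_word (haa : a.Comm a) (hab : a.Comm b) (hbb : b.Comm b)
    (hc : ∀ W (t : T.obj (op W)), T.map (create c W).op (a.app _ (b.app W t)) = t)
    {i j : Word.{w}} {f : i.eval M N ⟶ j.eval M N} (hf : WordHom c i j f) :
    Compat f (word a b i) (word a b j) := by
  induction hf with
  | id i => exact Compat.id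
  | comp _ _ hf hg => exact hf.comp hg
  | whiskerLeft k _ hf => exact hf.whiskerLeft (word a b k)
  | whiskerRight k _ hf => exact hf.whiskerRight (word a b k)
  | associator i j k => exact compat_associator (word a b i) (word a b j) (word a b k)
  | leftUnitor i => exact compat_leftUnitor (word a b i)
  | braiding i j => exact (word_comm_word haa hab hbb i j).compat_braiding
  | create => exact compat_create hc

end PshOp

end Words

/-! ### The action of words on mixed tensor powers -/

section MixedPsh

variable {D : Type u} [Category.{v} D] [MonoidalCategory D] [SymmetricCategory D]
  [Preadditive D] [MonoidalPreadditive D] {M N : D} (c : 𝟙_ D ⟶ M ⊗ N)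

/-- The relation between a morphism from `W` to a mixed tensor power and its product with `c`. -/
inductive MixedRel (W : D) : (_ _ : (p : ℕ × ℕ) × (W ⟶ mixed M N p.1 p.2)) → Prop
  | mk (p q : ℕ) (φ : W ⟶ mixed M N p q) :
    MixedRel W ⟨(p, q), φ⟩ ⟨(p + 1, q + 1), φ ≫ mulElt c p q⟩

/-- The presheaf of morphisms to mixed tensor powers, up to multiplication by `c`. -/
def mixedPsh : Dᵒᵖ ⥤ Type v where
  obj W := Quot (MixedRel c W.unop)
  map f := TypeCat.ofHom (Quot.map (fun φ => ⟨φ.1, f.unop ≫ φ.2⟩) (by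
    rintro _ _ ⟨p, q, φ⟩
    dsimp only
    rw [← Category.assoc]
    exact .mk p q _))
  map_id W := by
    ext ⟨φ⟩
    exact congrArg (fun t => Quot.mk (MixedRel c W.unop) ⟨φ.1, t⟩) (Category.id_comp φ.2)
  map_comp {_ _ W} f g := by
    ext ⟨φ⟩
    exact congrArg (fun t => Quot.mk (MixedRel c W.unop) ⟨φ.1, t⟩)
      (Category.assoc g.unop f.unop φ.2)

/-- The class of a morphism in `mixedPsh`. -/
def mixedMk {W : D} {p q : ℕ} (φ : W ⟶ mixed M N p q) : (mixedPsh c).obj (op W) :=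
  Quot.mk _ ⟨(p, q), φ⟩

lemma mixedMk_mulElt {W : D} {p q : ℕ} (φ : W ⟶ mixed M N p q) :
    mixedMk c (φ ≫ mulElt c p q) = mixedMk c φ := (Quot.sound (.mk p q φ)).symm

/-- The operators creating `M` on `mixedPsh`. -/
def mixedFst : PshOp (mixedPsh c) M where
  app W := Quot.map (fun φ => ⟨(φ.1.1 + 1, φ.1.2), M ◁ φ.2 ≫ insFst M N φ.1.1 φ.1.2⟩) (by
    rintro _ _ ⟨p, q, φ⟩
    dsimp only
    rw [MonoidalCategory.whiskerLeft_comp, Category.assoc, mulElt_insFst, ← Category.assoc]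
    exact .mk (p + 1) q _)
  naturality f t := by
    obtain ⟨⟨⟨p, q⟩, φ⟩⟩ := t
    change mixedMk c (M ◁ (f ≫ φ) ≫ insFst M N p q) = mixedMk c (M ◁ f ≫ M ◁ φ ≫ insFst M N p q)
    rw [MonoidalCategory.whiskerLeft_comp_assoc]

/-- The operators creating `N` on `mixedPsh`. -/
def mixedSnd : PshOp (mixedPsh c) N where
  app W := Quot.map (fun φ => ⟨(φ.1.1, φ.1.2 + 1), N ◁ φ.2 ≫ insSnd M N φ.1.1 φ.1.2⟩) (by
    rintro _ _ ⟨p, q, φ⟩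
    dsimp only
    rw [MonoidalCategory.whiskerLeft_comp, Category.assoc, mulElt_insSnd, ← Category.assoc]
    exact .mk p (q + 1) _)
  naturality f t := by
    obtain ⟨⟨⟨p, q⟩, φ⟩⟩ := t
    change mixedMk c (N ◁ (f ≫ φ) ≫ insSnd M N p q) = mixedMk c (N ◁ f ≫ N ◁ φ ≫ insSnd M N p q)
    rw [MonoidalCategory.whiskerLeft_comp_assoc]

lemma mixedFst_comm_mixedFst : (mixedFst c).Comm (mixedFst c) := by
  rintro W ⟨⟨⟨p, q⟩, φ⟩⟩
  refine congrArg (mixedMk c) (?_ : leftComm M M W ≫ M ◁ (M ◁ φ ≫ insFst M N p q) ≫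
    insFst M N (p + 1) q = M ◁ (M ◁ φ ≫ insFst M N p q) ≫ insFst M N (p + 1) q)
  rw [MonoidalCategory.whiskerLeft_comp_assoc, ← reassoc_of% @leftComm_naturality, insFst_insFst]

lemma mixedFst_comm_mixedSnd : (mixedFst c).Comm (mixedSnd c) := by
  rintro W ⟨⟨⟨p, q⟩, φ⟩⟩
  refine congrArg (mixedMk c) (?_ : leftComm M N W ≫ N ◁ (M ◁ φ ≫ insFst M N p q) ≫
    insSnd M N (p + 1) q = M ◁ (N ◁ φ ≫ insSnd M N p q) ≫ insFst M N p (q + 1))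
  rw [MonoidalCategory.whiskerLeft_comp_assoc, ← reassoc_of% @leftComm_naturality, ← insSnd_insFst,
    MonoidalCategory.whiskerLeft_comp_assoc]

lemma mixedSnd_comm_mixedSnd : (mixedSnd c).Comm (mixedSnd c) := by
  rintro W ⟨⟨⟨p, q⟩, φ⟩⟩
  refine congrArg (mixedMk c) (?_ : leftComm N N W ≫ N ◁ (N ◁ φ ≫ insSnd M N p q) ≫
    insSnd M N p (q + 1) = N ◁ (N ◁ φ ≫ insSnd M N p q) ≫ insSnd M N p (q + 1))
  rw [MonoidalCategory.whiskerLeft_comp_assoc, ← reassoc_of% @leftComm_naturality, insSnd_insSnd]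

lemma map_create_mixed (W : D) (t : (mixedPsh c).obj (op W)) :
    (mixedPsh c).map (create c W).op ((mixedFst c).app _ ((mixedSnd c).app W t)) = t := by
  obtain ⟨⟨⟨p, q⟩, φ⟩⟩ := t
  refine Eq.trans (congrArg (mixedMk c) (?_ : create c W ≫ M ◁ (N ◁ φ ≫ insSnd M N p q) ≫
    insFst M N p (q + 1) = φ ≫ mulElt c p q)) (mixedMk_mulElt c φ)
  rw [mulElt, reassoc_of% @create_naturality, MonoidalCategory.whiskerLeft_comp_assoc]

variable {C : Type*} [Category.{v} C] (G : D ⥤ C) {Y : C}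
  (y : ∀ p q, G.obj (mixed M N p q) ⟶ Y)
  (hy : ∀ p q, G.map (mulElt c p q) ≫ y (p + 1) (q + 1) = y p q)

/-- The morphism to `Y` given by a section of `mixedPsh` and by compatible morphisms from the
mixed tensor powers to `Y`. -/
def mixedDesc {W : D} : (mixedPsh c).obj (op W) → (G.obj W ⟶ Y) :=
  Quot.lift (fun φ => G.map φ.2 ≫ y φ.1.1 φ.1.2) (by
    rintro _ _ ⟨p, q, φ⟩
    dsimp only
    rw [G.map_comp, Category.assoc, hy])

lemma mixedDesc_map {W W' : D} (f : W' ⟶ W) (t : (mixedPsh c).obj (op W)) :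
    mixedDesc c G y hy ((mixedPsh c).map f.op t) = G.map f ≫ mixedDesc c G y hy t := by
  obtain ⟨⟨⟨p, q⟩, φ⟩⟩ := t
  change G.map (f ≫ φ) ≫ y p q = G.map f ≫ G.map φ ≫ y p q
  rw [G.map_comp, Category.assoc]

/-- The morphism to `Y` from the value of a word: the word acts on the unit section. -/
def wordDesc (i : Word.{v}) : G.obj (i.eval M N) ⟶ Y :=
  mixedDesc c G y hy ((mixedPsh c).map (ρ_ _).inv.op
    ((PshOp.word (mixedFst c) (mixedSnd c) i).app (𝟙_ D)
      (mixedMk c (p := 0) (q := 0) (λ_ (𝟙_ D)).inv)))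

lemma map_wordDesc {i j : Word.{v}} {f : i.eval M N ⟶ j.eval M N} (hf : WordHom c i j f) :
    G.map f ≫ wordDesc c G y hy j = wordDesc c G y hy i := by
  rw [wordDesc, wordDesc, ← mixedDesc_map, PshOp.map_map, rightUnitor_inv_naturality,
    ← PshOp.map_map]
  congr 2
  exact PshOp.compat_word c (mixedFst_comm_mixedFst c) (mixedFst_comm_mixedSnd c)
    (mixedSnd_comm_mixedSnd c) (map_create_mixed c) hf _ _

lemma wordDesc_unit : wordDesc c G y hy .unit = G.map (λ_ (𝟙_ D)).inv ≫ y 0 0 := by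
  change G.map ((ρ_ _).inv ≫ (λ_ _).hom ≫ (λ_ (𝟙_ D)).inv) ≫ y 0 0 = _
  rw [Iso.hom_inv_id, Category.comp_id, unitors_inv_equal]

end MixedPsh

/-! ### Additivity for modules -/

section ModAdditive

variable {C : Type u} [Category.{v} C] [MonoidalCategory C] [Preadditive C]
  [MonoidalPreadditive C] {A : C} [MonObj A]

/-- Linear combinations of module morphisms are module morphisms. -/
def modHomAddSubgroup (M N : Mod C A) : AddSubgroup (M.X ⟶ N.X) where
  carrier := { f | lact M ≫ f = A ◁ f ≫ lact N }
  add_mem' {f g} hf hg := by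
    simp only [Set.mem_ofPred_eq] at hf hg ⊢
    rw [Preadditive.comp_add, MonoidalPreadditive.whiskerLeft_add, Preadditive.add_comp, hf, hg]
  zero_mem' := by simp
  neg_mem' {f} hf := by
    simp only [Set.mem_ofPred_eq] at hf ⊢
    have h : A ◁ (-f) = -(A ◁ f) := (tensorLeft A).map_neg
    rw [Preadditive.comp_neg, h, Preadditive.neg_comp, hf]

/-- Module morphisms as an additive group of morphisms. -/
def modHomEquiv (M N : Mod C A) : (M ⟶ N) ≃ modHomAddSubgroup M N where
  toFun f := ⟨f.hom, lact_hom f⟩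
  invFun f := Mod.Hom.mk' f.1 f.2

noncomputable instance : Preadditive (Mod C A) where
  homGroup M N := (modHomEquiv M N).addCommGroup
  add_comp _ _ _ _ _ _ := Mod.hom_ext _ _ (Preadditive.add_comp ..)
  comp_add _ _ _ _ _ _ := Mod.hom_ext _ _ (Preadditive.comp_add ..)

/-- Passage to the underlying morphism, as a homomorphism of groups. -/
noncomputable def modHomAddHom (M N : Mod C A) : (M ⟶ N) →+ (M.X ⟶ N.X) where
  toFun f := f.hom
  map_zero' := rfl
  map_add' _ _ := rfl

lemma mod_add_hom {M N : Mod C A} (f g : M ⟶ N) : (f + g).hom = f.hom + g.hom := rfl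

lemma mod_zero_hom (M N : Mod C A) : (0 : M ⟶ N).hom = 0 := rfl

lemma mod_nsmul_hom {M N : Mod C A} (n : ℕ) (f : M ⟶ N) : (n • f).hom = n • f.hom :=
  map_nsmul (modHomAddHom M N) n f

lemma mod_sum_hom {M N : Mod C A} {ι : Type*} (s : Finset ι) (f : ι → (M ⟶ N)) :
    (∑ i ∈ s, f i).hom = ∑ i ∈ s, (f i).hom :=
  map_sum (modHomAddHom M N) f s

variable [SymmetricCategory C] [HasCoequalizers C]
  [∀ X : C, PreservesColimitsOfShape WalkingParallelPair (tensorLeft X)] [IsCommMonObj A]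

instance : MonoidalPreadditive (Mod C A) where
  whiskerLeft_zero := mod_hom_ext (by simp [modπ_whiskerLeft, mod_zero_hom])
  zero_whiskerRight := mod_hom_ext (by simp [modπ_whiskerRight, mod_zero_hom])
  whiskerLeft_add f g := mod_hom_ext (by
    simp [modπ_whiskerLeft, mod_add_hom, MonoidalPreadditive.whiskerLeft_add])
  add_whiskerRight f g := mod_hom_ext (by
    simp [modπ_whiskerRight, mod_add_hom, MonoidalPreadditive.add_whiskerRight])

lemma symmetrizer_eq [HasImages C] (M : Mod C A) (n : ℕ) :
    symmetrizer M n = (symOp M n).hom := by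
  rw [symOp_eq_sum, mod_sum_hom, symmetrizer]

lemma isZero_symPow_iff [HasImages C] [HasZeroObject C] [HasEqualizers C]
    (M : Mod C A) (n : ℕ) : IsZero (symPow M n) ↔ symOp M n = 0 := by
  rw [symPow]
  constructor
  · intro h
    apply Mod.hom_ext
    rw [← symmetrizer_eq, ← image.fac (symmetrizer M n), h.eq_of_tgt (factorThruImage _) 0,
      zero_comp]
    rfl
  · intro h
    have h0 : symmetrizer M n = 0 := by rw [symmetrizer_eq, h]; rfl
    have : image.ι (symmetrizer M n) = 0 := by
      rw [← cancel_epi (factorThruImage _), image.fac, h0, comp_zero]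
    rw [IsZero.iff_id_eq_zero, ← cancel_mono (image.ι (symmetrizer M n)), this, comp_zero,
      comp_zero]

end ModAdditive

/-! ### The commutative algebra of words -/

section WordAlgebra

open scoped MonObj

variable {C : Type u} [Category.{v} C] [MonoidalCategory C] [SymmetricCategory C]
  [HasCoequalizers C] [∀ X : C, PreservesColimitsOfShape WalkingParallelPair (tensorLeft X)]
  {A : C} [MonObj A] [IsCommMonObj A] {M N : Mod C A} (c : 𝟙_ (Mod C A) ⟶ M ⊗ N)
  [HasColimitsOfShape (WordCat.{v, max u v, v} c) C]

/-- The colimit of the values of all words, over the category of words. It is the universal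
commutative `A`-algebra with morphisms from `M` and `N` whose product sends `c` to `1`. -/
noncomputable def wordAlg : C := colimit (wordFunctor c ⋙ Mod.forget A)

/-- The morphism from the value of a word to the algebra of words. -/
noncomputable def wordι (i : Word.{v}) : (i.eval M N).X ⟶ wordAlg c :=
  colimit.ι (wordFunctor c ⋙ Mod.forget A) i

variable {c} in
lemma wordι_w {i j : Word.{v}} {f : i.eval M N ⟶ j.eval M N} (hf : WordHom c i j f) :
    f.hom ≫ wordι c j = wordι c i :=
  colimit.w (wordFunctor c ⋙ Mod.forget A) (j := (j : WordCat c)) (j' := (i : WordCat c)) ⟨f, hf⟩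

/-- The morphism from `A`, the value of the empty word, to the algebra of words. -/
noncomputable def wordUnit : A ⟶ wordAlg c := wordι c .unit

/-- The morphism from the tensor product of the values of two words to the algebra of words. -/
noncomputable def wordPair (i j : Word.{v}) : (i.eval M N ⊗ j.eval M N).X ⟶ wordAlg c :=
  wordι c (.tensor i j)

variable {c} in
lemma whiskerLeft_wordPair (i : Word.{v}) {j k : Word.{v}} {f : j.eval M N ⟶ k.eval M N}
    (hf : WordHom c j k f) : (i.eval M N ◁ f).hom ≫ wordPair c i k = wordPair c i j :=
  wordι_w (.whiskerLeft i hf)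

variable {c} in
lemma whiskerRight_wordPair {i j : Word.{v}} {f : i.eval M N ⟶ j.eval M N} (hf : WordHom c i j f)
    (k : Word.{v}) : (f ▷ k.eval M N).hom ≫ wordPair c j k = wordPair c i k :=
  wordι_w (.whiskerRight k hf)

lemma braiding_wordPair (i j : Word.{v}) :
    (β_ (i.eval M N) (j.eval M N)).hom.hom ≫ wordPair c j i = wordPair c i j :=
  wordι_w (.braiding i j)

/-- A morphism out of the algebra of words. -/
noncomputable def wordAlgDesc {Y : C} (k : ∀ i : Word.{v}, (i.eval M N).X ⟶ Y)
    (hk : ∀ (i j : Word.{v}) (f : i.eval M N ⟶ j.eval M N), WordHom c i j f → f.hom ≫ k j = k i) :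
    wordAlg c ⟶ Y :=
  colimit.desc (wordFunctor c ⋙ Mod.forget A)
    ⟨Y, { app := k, naturality := fun _ _ f => (hk _ _ _ f.2).trans (Category.comp_id _).symm }⟩

lemma wordι_desc {Y : C} (k : ∀ i : Word.{v}, (i.eval M N).X ⟶ Y)
    (hk : ∀ (i j : Word.{v}) (f : i.eval M N ⟶ j.eval M N), WordHom c i j f → f.hom ≫ k j = k i)
    (i : Word.{v}) : wordι c i ≫ wordAlgDesc c k hk = k i :=
  colimit.ι_desc _ _

variable [∀ X : C, PreservesColimitsOfShape (WordCat.{v, max u v, v} c) (tensorLeft X)]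

variable {c} in
lemma wordAlg_hom_ext_left {X W : C} {f g : X ⊗ wordAlg c ⟶ W}
    (h : ∀ i, X ◁ wordι c i ≫ f = X ◁ wordι c i ≫ g) : f = g :=
  (isColimitOfPreserves (tensorLeft X) (colimit.isColimit (wordFunctor c ⋙ Mod.forget A))).hom_ext h

variable {c} in
lemma wordAlg_hom_ext_right {X W : C} {f g : wordAlg c ⊗ X ⟶ W}
    (h : ∀ i, wordι c i ▷ X ≫ f = wordι c i ▷ X ≫ g) : f = g := by
  rw [← cancel_epi (β_ X (wordAlg c)).hom]
  apply wordAlg_hom_ext_left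
  intro i
  rw [BraidedCategory.braiding_naturality_right_assoc,
    BraidedCategory.braiding_naturality_right_assoc, h]

variable {c} in
lemma wordAlg_hom_ext_right_right {X Y W : C} {f g : (wordAlg c ⊗ X) ⊗ Y ⟶ W}
    (h : ∀ i, wordι c i ▷ X ▷ Y ≫ f = wordι c i ▷ X ▷ Y ≫ g) : f = g := by
  rw [← cancel_epi (α_ _ _ _).inv]
  apply wordAlg_hom_ext_right
  intro i
  rw [associator_inv_naturality_left_assoc, associator_inv_naturality_left_assoc, h]

variable {c} in
lemma wordAlg_hom_ext_left_right {X Y W : C} {f g : (X ⊗ wordAlg c) ⊗ Y ⟶ W}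
    (h : ∀ i, (X ◁ wordι c i) ▷ Y ≫ f = (X ◁ wordι c i) ▷ Y ≫ g) : f = g := by
  rw [← cancel_epi ((β_ _ _).hom ▷ Y)]
  apply wordAlg_hom_ext_right_right
  intro i
  simp only [← comp_whiskerRight_assoc, BraidedCategory.braiding_naturality_left]
  rw [comp_whiskerRight_assoc, h, comp_whiskerRight_assoc]

/-- A morphism out of `X ⊗ B`, where `B` is the algebra of words. -/
noncomputable def wordDescL {X W : C} (k : ∀ i : Word.{v}, X ⊗ (i.eval M N).X ⟶ W)
    (hk : ∀ (i j : Word.{v}) (f : i.eval M N ⟶ j.eval M N), WordHom c i j f →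
      X ◁ f.hom ≫ k j = k i) : X ⊗ wordAlg c ⟶ W :=
  (isColimitOfPreserves (tensorLeft X) (colimit.isColimit (wordFunctor c ⋙ Mod.forget A))).desc
    ⟨W, { app := k, naturality := fun _ _ f => (hk _ _ _ f.2).trans (Category.comp_id _).symm }⟩

lemma wordι_descL {X W : C} (k : ∀ i : Word.{v}, X ⊗ (i.eval M N).X ⟶ W)
    (hk : ∀ (i j : Word.{v}) (f : i.eval M N ⟶ j.eval M N), WordHom c i j f →
      X ◁ f.hom ≫ k j = k i) (i : Word.{v}) : X ◁ wordι c i ≫ wordDescL c k hk = k i :=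
  (isColimitOfPreserves (tensorLeft X) (colimit.isColimit (wordFunctor c ⋙ Mod.forget A))).fac _ _

/-- The product of a word with an element of the algebra of words. -/
noncomputable def wordMulLeft (i : Word.{v}) : (i.eval M N).X ⊗ wordAlg c ⟶ wordAlg c :=
  wordDescL c (fun j => modπ (i.eval M N) (j.eval M N) ≫ wordPair c i j) (by
    intro j k f hf
    rw [← reassoc_of% @modπ_whiskerLeft, whiskerLeft_wordPair i hf])

lemma wordι_mulLeft (i j : Word.{v}) : (i.eval M N).X ◁ wordι c j ≫ wordMulLeft c i =
    modπ (i.eval M N) (j.eval M N) ≫ wordPair c i j :=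
  wordι_descL _ _ _ _

/-- The product of the algebra of words, induced by the concatenation of words. -/
noncomputable def wordMul : wordAlg c ⊗ wordAlg c ⟶ wordAlg c :=
  (β_ _ _).hom ≫ wordDescL c (fun i => (β_ _ _).hom ≫ wordMulLeft c i) (by
    intro i j f hf
    rw [BraidedCategory.braiding_naturality_right_assoc]
    congr 1
    apply wordAlg_hom_ext_left
    intro k
    rw [whisker_exchange_assoc, wordι_mulLeft, wordι_mulLeft, ← reassoc_of% @modπ_whiskerRight,
      whiskerRight_wordPair hf])

lemma wordι_whiskerRight_mul (i : Word.{v}) : wordι c i ▷ wordAlg c ≫ wordMul c =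
    wordMulLeft c i := by
  rw [wordMul, BraidedCategory.braiding_naturality_left_assoc, wordι_descL,
    SymmetricCategory.symmetry_assoc]

lemma wordι_wordι_mul (i j : Word.{v}) :
    (i.eval M N).X ◁ wordι c j ≫ wordι c i ▷ wordAlg c ≫ wordMul c =
      modπ (i.eval M N) (j.eval M N) ≫ wordPair c i j := by
  rw [wordι_whiskerRight_mul, wordι_mulLeft]

lemma wordMul_comm : (β_ (wordAlg c) (wordAlg c)).hom ≫ wordMul c = wordMul c := by
  apply wordAlg_hom_ext_right
  intro i
  apply wordAlg_hom_ext_left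
  intro j
  rw [BraidedCategory.braiding_naturality_left_assoc,
    BraidedCategory.braiding_naturality_right_assoc, ← whisker_exchange_assoc, wordι_wordι_mul,
    wordι_wordι_mul, ← braiding_wordPair c i j, ← Category.assoc, ← Category.assoc]
  exact congrArg (· ≫ wordPair c j i) (modπ_braiding (i.eval M N) (j.eval M N)).symm

/-- The product of an element of `A`, seen as the value of the empty word, with a word. -/
lemma wordι_unit_mul (i : Word.{v}) :
    A ◁ wordι c i ≫ wordUnit c ▷ wordAlg c ≫ wordMul c = lact (i.eval M N) ≫ wordι c i := by
  refine (wordι_wordι_mul c .unit i).trans ?_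
  rw [← modπ_leftUnitor, Category.assoc]
  exact congrArg (modπ _ _ ≫ ·) (wordι_w (.leftUnitor i)).symm

lemma wordMul_one_mul : (η[A] ≫ wordUnit c) ▷ wordAlg c ≫ wordMul c =
    (λ_ (wordAlg c)).hom := by
  apply wordAlg_hom_ext_left
  intro i
  rw [comp_whiskerRight_assoc, whisker_exchange_assoc]
  rw [wordι_unit_mul, ← Category.assoc, one_lact, leftUnitor_naturality]

/-- Associativity of a product `m` on `B`, tested on morphisms from `A`-modules to `B` whose
products are morphisms from the tensor products over `A`. -/
lemma mul_assoc_of_modπ {B : C} {m : B ⊗ B ⟶ B} {P Q R : Mod C A} {p : P.X ⟶ B} {q : Q.X ⟶ B}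
    {r : R.X ⟶ B} {pq : (P ⊗ Q).X ⟶ B} {qr : (Q ⊗ R).X ⟶ B} {s : ((P ⊗ Q) ⊗ R).X ⟶ B}
    {t : (P ⊗ (Q ⊗ R)).X ⟶ B} (hpq : P.X ◁ q ≫ p ▷ B ≫ m = modπ P Q ≫ pq)
    (hs : (P ⊗ Q).X ◁ r ≫ pq ▷ B ≫ m = modπ (P ⊗ Q) R ≫ s)
    (hqr : Q.X ◁ r ≫ q ▷ B ≫ m = modπ Q R ≫ qr)
    (ht : P.X ◁ qr ≫ p ▷ B ≫ m = modπ P (Q ⊗ R) ≫ t) (hst : (α_ P Q R).hom.hom ≫ t = s) :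
    (P.X ⊗ Q.X) ◁ r ≫ (P.X ◁ q ≫ p ▷ B) ▷ B ≫ m ▷ B ≫ m =
      (α_ P.X Q.X R.X).hom ≫ P.X ◁ (Q.X ◁ r ≫ q ▷ B ≫ m) ≫ p ▷ B ≫ m := by
  rw [← comp_whiskerRight_assoc, Category.assoc, hpq, comp_whiskerRight_assoc,
    whisker_exchange_assoc, hs, ← hst, reassoc_of% @modπ_associator, ← ht, hqr,
    MonoidalCategory.whiskerLeft_comp_assoc]

lemma wordMul_assoc : wordMul c ▷ wordAlg c ≫ wordMul c =
    (α_ _ _ _).hom ≫ wordAlg c ◁ wordMul c ≫ wordMul c := by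
  apply wordAlg_hom_ext_right_right
  intro i
  apply wordAlg_hom_ext_left_right
  intro j
  apply wordAlg_hom_ext_left
  intro k
  have h := mul_assoc_of_modπ (wordι_wordι_mul c i j) (wordι_wordι_mul c (.tensor i j) k)
    (wordι_wordι_mul c j k) (wordι_wordι_mul c i (.tensor j k)) (wordι_w (.associator i j k))
  simp only [comp_whiskerRight, MonoidalCategory.whiskerLeft_comp, Category.assoc] at h
  rw [h, associator_naturality_left_assoc, associator_naturality_middle_assoc,
    associator_naturality_right_assoc, ← whisker_exchange_assoc]

noncomputable instance : MonObj (wordAlg c) where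
  one := η[A] ≫ wordUnit c
  mul := wordMul c
  one_mul := wordMul_one_mul c
  mul_one := by
    rw [← wordMul_comm, BraidedCategory.braiding_naturality_right_assoc, wordMul_one_mul]
    simp
  mul_assoc := wordMul_assoc c

instance : IsCommMonObj (wordAlg c) where
  mul_comm := wordMul_comm c

instance : IsMonHom (wordUnit c) where
  one_hom := rfl
  mul_hom := by
    have h : A ◁ wordUnit c ≫ wordUnit c ▷ wordAlg c ≫ wordMul c = μ[A] ≫ wordUnit c :=
      wordι_unit_mul c .unit
    rw [MonoidalCategory.tensorHom_def', Category.assoc]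
    exact h.symm

end WordAlgebra

/-! ### Extension of scalars and direct summands -/

section ExtensionOfScalars

open scoped MonObj

variable {C : Type u} [Category.{v} C] [MonoidalCategory C] [SymmetricCategory C]
  [HasCoequalizers C] [∀ X : C, PreservesColimitsOfShape WalkingParallelPair (tensorLeft X)]
  {A : C} [MonObj A] [IsCommMonObj A] {B : C} [MonObj B] [IsCommMonObj B] (f : A ⟶ B) [IsMonHom f]

lemma ract_restr : ract (restrMod f) = B ◁ f ≫ μ[B] := by
  rw [ract, lact_restr]
  change (β_ B A).hom ≫ f ▷ B ≫ μ[B] = _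
  rw [← BraidedCategory.braiding_naturality_right_assoc, IsCommMonObj.mul_comm]

variable {f} {M : Mod C A}

lemma lact_hom_restr {M : Mod C A} (a : M ⟶ restrMod f) :
    lact M ≫ a.hom = A ◁ a.hom ≫ f ▷ B ≫ μ[B] := lact_hom a

lemma whiskerLeft_mul_balanced (a : M ⟶ restrMod f) :
    ract (restrMod f) ▷ M.X ≫ B ◁ a.hom ≫ μ[B] =
      (α_ B A M.X).hom ≫ B ◁ lact M ≫ B ◁ a.hom ≫ μ[B] := by
  rw [ract_restr, ← MonoidalCategory.whiskerLeft_comp_assoc, lact_hom_restr]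
  change (B ◁ f ≫ μ[B]) ▷ M.X ≫ B ◁ a.hom ≫ μ[B] = (α_ B A M.X).hom ≫ _
  rw [← whisker_exchange_assoc, comp_whiskerRight_assoc, MonObj.mul_assoc]
  simp only [MonoidalCategory.whiskerLeft_comp, Category.assoc]
  rw [← associator_naturality_right_assoc, associator_naturality_middle_assoc]

/-- The `B`-linear morphism `B ⊗_A M ⟶ B` induced by an `A`-linear morphism `M ⟶ B`. -/
noncomputable def extDesc (a : M ⟶ restrMod f) : extScalars f M ⟶ regMod B :=
  Mod.Hom.mk' (tDesc (M := restrMod f) (B ◁ a.hom ≫ μ[B]) (whiskerLeft_mul_balanced a)) (by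
    change extAct f M ≫ _ = B ◁ _ ≫ μ[B]
    generalize hd : tDesc (M := restrMod f) (B ◁ a.hom ≫ μ[B]) (whiskerLeft_mul_balanced a) = d
    have hd' : tπ (restrMod f) M ≫ d = B ◁ a.hom ≫ μ[B] := by rw [← hd, tπ_desc]
    rw [← cancel_epi (B ◁ tπ (restrMod f) M), reassoc_of% @tπ_extAct,
      ← MonoidalCategory.whiskerLeft_comp_assoc, hd']
    change (α_ B B M.X).inv ≫ μ[B] ▷ M.X ≫ B ◁ a.hom ≫ μ[B] = _
    rw [← whisker_exchange_assoc, MonObj.mul_assoc]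
    simp)

lemma tπ_extDesc (a : M ⟶ restrMod f) :
    tπ (restrMod f) M ≫ (extDesc a).hom = B ◁ a.hom ≫ μ[B] :=
  tπ_desc _ (whiskerLeft_mul_balanced a)

/-- The morphism `B ⟶ P`, `b ↦ b x`, given by an element `x` of a `B`-module `P`. -/
def regDesc (P : Mod C B) (x : 𝟙_ C ⟶ P.X) : regMod B ⟶ P :=
  Mod.Hom.mk' ((ρ_ B).inv ≫ B ◁ x ≫ lact P) (by
    change μ[B] ≫ (ρ_ B).inv ≫ B ◁ x ≫ lact P = B ◁ ((ρ_ B).inv ≫ B ◁ x ≫ lact P) ≫ lact P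
    rw [rightUnitor_inv_naturality_assoc, ← whisker_exchange_assoc, mul_lact]
    simp)

lemma regDesc_comp {P : Mod C B} (x : 𝟙_ C ⟶ P.X) (g : P ⟶ regMod B) (h : x ≫ g.hom = η[B]) :
    regDesc P x ≫ g = 𝟙 _ := by
  apply Mod.hom_ext
  change ((ρ_ B).inv ≫ B ◁ x ≫ lact P) ≫ g.hom = 𝟙 B
  have hg : lact P ≫ g.hom = B ◁ g.hom ≫ μ[B] := lact_hom g
  rw [Category.assoc, Category.assoc, hg, ← MonoidalCategory.whiskerLeft_comp_assoc, h,
    MonObj.mul_one, Iso.inv_hom_id]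

section Restriction

/-! In this section `t` stands for the projection `B ⊗ M ⟶ B ⊗_A M`, `act` for the action of `B` on
its target and `r` for a `B`-linear form. -/

variable {X T : C} {t : B ⊗ X ⟶ T} {act : B ⊗ T ⟶ T} {r : T ⟶ B}

lemma comp_eq_whiskerLeft_mul (ht : B ◁ t ≫ act = (α_ B B X).inv ≫ μ[B] ▷ X ≫ t)
    (hr : act ≫ r = B ◁ r ≫ μ[B]) :
    t ≫ r = B ◁ ((λ_ X).inv ≫ η[B] ▷ X ≫ t ≫ r) ≫ μ[B] := by
  simp only [MonoidalCategory.whiskerLeft_comp, Category.assoc]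
  rw [← hr, reassoc_of% ht, associator_inv_naturality_middle_assoc,
    ← comp_whiskerRight_assoc, MonObj.mul_one]
  simp

lemma linear_of_balanced {l : A ⊗ X ⟶ X}
    (hl : (B ◁ f ≫ μ[B]) ▷ X ≫ t = (α_ B A X).hom ≫ B ◁ l ≫ t)
    (ht : B ◁ t ≫ act = (α_ B B X).inv ≫ μ[B] ▷ X ≫ t) (hr : act ≫ r = B ◁ r ≫ μ[B]) :
    l ≫ (λ_ X).inv ≫ η[B] ▷ X ≫ t ≫ r =
      A ◁ ((λ_ X).inv ≫ η[B] ▷ X ≫ t ≫ r) ≫ f ▷ B ≫ μ[B] := by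
  have h : (λ_ A).inv ≫ η[B] ▷ A ≫ B ◁ f ≫ μ[B] = f := by
    rw [← whisker_exchange_assoc, MonObj.one_mul]
    simp
  rw [whisker_exchange_assoc, ← comp_eq_whiskerLeft_mul ht hr, leftUnitor_inv_naturality_assoc,
    whisker_exchange_assoc]
  rw [← Iso.inv_comp_eq] at hl
  rw [← reassoc_of% hl]
  conv_rhs => rw [← h]
  simp

end Restriction

/-- The `A`-linear morphism `M ⟶ B` that is the restriction of a `B`-linear morphism
`B ⊗_A M ⟶ B`. -/
noncomputable def extRestr (r : extScalars f M ⟶ regMod B) : M ⟶ restrMod f :=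
  Mod.Hom.mk' ((λ_ M.X).inv ≫ η[B] ▷ M.X ≫ tπ (restrMod f) M ≫ r.hom)
    (linear_of_balanced (t := tπ (restrMod f) M)
      (by have h := tπ_condition (restrMod f) M; rw [ract_restr] at h; exact h)
      (tπ_extAct f M) (lact_hom r))

lemma tπ_comp_eq (r : extScalars f M ⟶ regMod B) :
    tπ (restrMod f) M ≫ r.hom = B ◁ (extRestr r).hom ≫ μ[B] :=
  comp_eq_whiskerLeft_mul (tπ_extAct f M) (lact_hom r)

end ExtensionOfScalars

section Words

open scoped MonObj

variable {C : Type u} [Category.{v} C] [MonoidalCategory C] [SymmetricCategory C]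
  [HasCoequalizers C] [∀ X : C, PreservesColimitsOfShape WalkingParallelPair (tensorLeft X)]
  {A : C} [MonObj A] [IsCommMonObj A] {M N : Mod C A} (c : 𝟙_ (Mod C A) ⟶ M ⊗ N)
  [HasColimitsOfShape (WordCat.{v, max u v, v} c) C]
  [∀ X : C, PreservesColimitsOfShape (WordCat.{v, max u v, v} c) (tensorLeft X)]

/-- The morphism from the value of a word to the algebra of words is linear. -/
noncomputable def wordHomRestr (i : Word.{v}) : i.eval M N ⟶ restrMod (wordUnit c) :=
  Mod.Hom.mk' (wordι c i) (wordι_unit_mul c i).symm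

lemma whiskerRight_extDesc :
    (wordHomRestr c .snd ▷ M).hom ≫ (extDesc (wordHomRestr c .fst)).hom =
      wordPair c .snd .fst := by
  refine (cancel_epi (modπ N M)).1 ?_
  refine (Category.assoc _ _ _).symm.trans ?_
  have h1 := modπ_whiskerRight (wordHomRestr c .snd) M
  refine (congrArg (· ≫ (extDesc (wordHomRestr c .fst)).hom) h1).trans ?_
  refine (Category.assoc _ _ _).trans ?_
  refine (congrArg ((wordι c .snd ▷ M.X) ≫ ·) (tπ_extDesc (wordHomRestr c .fst))).trans ?_
  refine (whisker_exchange_assoc _ _ _).symm.trans ?_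
  exact wordι_wordι_mul c .snd .fst

/-- Over the algebra of words `B`, the image of `c` in `B ⊗_A M`, together with the linear form
given by the word `fst`, makes the unit a direct summand of `B ⊗_A M`. -/
noncomputable def wordRetract : Retract (regMod (wordAlg c)) (extScalars (wordUnit c) M) where
  i := regDesc (extScalars (wordUnit c) M)
    (η[A] ≫ c.hom ≫ (β_ M N).hom.hom ≫ (wordHomRestr c .snd ▷ M).hom)
  r := extDesc (wordHomRestr c .fst)
  retract := regDesc_comp _ _ (by
    refine (Category.assoc _ _ _).trans (congrArg (η[A] ≫ ·) ?_)
    refine (Category.assoc _ _ _).trans ?_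
    refine Eq.trans (congrArg (c.hom ≫ ·) ((Category.assoc _ _ _).trans
      ((congrArg ((β_ M N).hom.hom ≫ ·) (whiskerRight_extDesc c)).trans
        (braiding_wordPair c .fst .snd)))) ?_
    exact wordι_w .create)

end Words

/-! ### Powers of a linear form with values in an algebra -/

section PowMap

variable {D : Type u} [Category.{v} D] [MonoidalCategory D] [SymmetricCategory D]
  {M R : D} (m : R ⊗ R ⟶ R) (e : 𝟙_ D ⟶ R) (a : M ⟶ R)

/-- The morphism `M^{⊗ n} ⟶ R` that applies `a` to each factor and multiplies the results. -/
def powMap : (n : ℕ) → (tpow M n ⟶ R)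
  | 0 => e
  | n + 1 => M ◁ powMap n ≫ a ▷ R ≫ m

variable {m}

lemma leftComm_mul (hcomm : (β_ R R).hom ≫ m = m)
    (hassoc : m ▷ R ≫ m = (α_ R R R).hom ≫ R ◁ m ≫ m) :
    leftComm R R R ≫ R ◁ m ≫ m = R ◁ m ≫ m := by
  have h : R ◁ m ≫ m = (α_ R R R).inv ≫ m ▷ R ≫ m := by rw [hassoc, Iso.inv_hom_id_assoc]
  rw [leftComm, Category.assoc, Category.assoc, ← hassoc, ← comp_whiskerRight_assoc, hcomm, h]

/-- Applying `a` to two factors and multiplying does not depend on the order of the factors. -/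
lemma leftComm_mul_comp (hcomm : (β_ R R).hom ≫ m = m)
    (hassoc : m ▷ R ≫ m = (α_ R R R).hom ≫ R ◁ m ≫ m) {T : D} (p : T ⟶ R) :
    leftComm M M T ≫ M ◁ (M ◁ p ≫ a ▷ R ≫ m) ≫ a ▷ R ≫ m =
      M ◁ (M ◁ p ≫ a ▷ R ≫ m) ≫ a ▷ R ≫ m := by
  have h : M ◁ (M ◁ p ≫ a ▷ R ≫ m) ≫ a ▷ R ≫ m =
      M ◁ M ◁ p ≫ M ◁ a ▷ R ≫ a ▷ (R ⊗ R) ≫ R ◁ m ≫ m := by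
    simp only [MonoidalCategory.whiskerLeft_comp, Category.assoc]
    rw [whisker_exchange_assoc]
  rw [h]
  conv_rhs => rw [← leftComm_mul hcomm hassoc, reassoc_of% @leftComm_naturality_left,
    reassoc_of% @leftComm_naturality_middle, reassoc_of% @leftComm_naturality,
    ← whisker_exchange_assoc]

lemma whiskerLeft_comp_powStep {T : D} {J : T ⟶ T} {q : T ⟶ R} (h : J ≫ q = q) :
    M ◁ J ≫ M ◁ q ≫ a ▷ R ≫ m = M ◁ q ≫ a ▷ R ≫ m := by
  rw [← MonoidalCategory.whiskerLeft_comp_assoc, h]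

lemma insertAt_powMap (hcomm : (β_ R R).hom ≫ m = m)
    (hassoc : m ▷ R ≫ m = (α_ R R R).hom ≫ R ◁ m ≫ m) (n i : ℕ) :
    insertAt M n i ≫ powMap m e a (n + 1) = powMap m e a (n + 1) := by
  induction n generalizing i with
  | zero => cases i <;> exact Category.id_comp _
  | succ n ih =>
    cases i with
    | zero => exact Category.id_comp _
    | succ i =>
      refine (Category.assoc _ _ _).trans ?_
      refine (congrArg (leftComm M M (tpow M n) ≫ ·) (whiskerLeft_comp_powStep a (ih i))).trans ?_
      exact leftComm_mul_comp a hcomm hassoc (powMap m e a n)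

lemma permAct_powMap (hcomm : (β_ R R).hom ≫ m = m)
    (hassoc : m ▷ R ≫ m = (α_ R R R).hom ≫ R ◁ m ≫ m) (n : ℕ) (σ : Equiv.Perm (Fin n)) :
    permAct M n σ ≫ powMap m e a n = powMap m e a n := by
  induction n with
  | zero => exact Category.id_comp _
  | succ n ih =>
    refine (Category.assoc _ _ _).trans ?_
    refine (congrArg (M ◁ permAct M n (tailPerm σ) ≫ ·)
      (insertAt_powMap e a hcomm hassoc n (σ 0))).trans ?_
    exact whiskerLeft_comp_powStep a (ih (tailPerm σ))

/-- Since `R` is commutative, the powers of `a` are invariant under permutations. -/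
lemma symOp_powMap [Preadditive D] [MonoidalPreadditive D] (hcomm : (β_ R R).hom ≫ m = m)
    (hassoc : m ▷ R ≫ m = (α_ R R R).hom ≫ R ◁ m ≫ m) (n : ℕ) :
    symOp M n ≫ powMap m e a n = n.factorial • powMap m e a n := by
  rw [symOp_eq_sum, Preadditive.sum_comp,
    Finset.sum_congr rfl fun σ _ => permAct_powMap e a hcomm hassoc n σ]
  simp [Fintype.card_perm]

end PowMap

section Restriction

open scoped MonObj

variable {C : Type u} [Category.{v} C] [MonoidalCategory C] [SymmetricCategory C]
  [HasCoequalizers C] [∀ X : C, PreservesColimitsOfShape WalkingParallelPair (tensorLeft X)]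
  {A : C} [MonObj A] [IsCommMonObj A] {B : C} [MonObj B] [IsCommMonObj B] (f : A ⟶ B) [IsMonHom f]

/-- The product of an `A`-algebra `B`, on the tensor product over `A`. -/
noncomputable def restrMul : restrMod f ⊗ restrMod f ⟶ restrMod f :=
  tensHomDesc (M := restrMod f) (N := restrMod f) μ[B]
    (by
      have h := whiskerLeft_mul_balanced (𝟙 (restrMod f))
      have h1 : B ◁ (𝟙 (restrMod f) : restrMod f ⟶ restrMod f).hom = 𝟙 _ :=
        MonoidalCategory.whiskerLeft_id _ _
      rw [h1, Category.id_comp] at h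
      exact h)
    (by
      change (f ▷ B ≫ μ[B]) ▷ B ≫ μ[B] = (α_ A B B).hom ≫ A ◁ μ[B] ≫ f ▷ B ≫ μ[B]
      rw [whisker_exchange_assoc, comp_whiskerRight_assoc, MonObj.mul_assoc]
      simp)

lemma modπ_restrMul : modπ (restrMod f) (restrMod f) ≫ (restrMul f).hom = μ[B] :=
  tπ_homDesc _ _ _

lemma restrMul_comm : (β_ (restrMod f) (restrMod f)).hom ≫ restrMul f = restrMul f :=
  mod_hom_ext (by
    rw [Mod.comp_hom', modπ_restrMul]
    refine (Category.assoc _ _ _).symm.trans ?_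
    refine (congrArg (· ≫ (restrMul f).hom) (modπ_braiding _ _)).trans ?_
    rw [Category.assoc, modπ_restrMul]
    exact IsCommMonObj.mul_comm B)

/-- A product on a module over `A` is associative if it is induced by an associative product on the
underlying object. -/
lemma mod_mul_assoc {R : Mod C A} {m : R ⊗ R ⟶ R} {t : R.X ⊗ R.X ⟶ R.X} (h : modπ R R ≫ m.hom = t)
    (ht : t ▷ R.X ≫ t = (α_ R.X R.X R.X).hom ≫ R.X ◁ t ≫ t) :
    m ▷ R ≫ m = (α_ R R R).hom ≫ R ◁ m ≫ m :=
  mod_hom_ext₃ (by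
    simp only [Mod.comp_hom']
    rw [reassoc_of% @modπ_whiskerRight, reassoc_of% @modπ_associator, h,
      reassoc_of% @modπ_whiskerLeft, h, ← comp_whiskerRight_assoc,
      ← MonoidalCategory.whiskerLeft_comp_assoc, h, ht])

lemma restrMul_assoc : restrMul f ▷ restrMod f ≫ restrMul f =
    (α_ (restrMod f) (restrMod f) (restrMod f)).hom ≫ restrMod f ◁ restrMul f ≫ restrMul f :=
  mod_mul_assoc (modπ_restrMul f) (MonObj.mul_assoc B)

/-- The structure morphism of an `A`-algebra as a morphism of `A`-modules. -/
noncomputable def restrUnit : 𝟙_ (Mod C A) ⟶ restrMod f :=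
  Mod.Hom.mk' (M := regMod A) f (by
    change μ[A] ≫ f = A ◁ f ≫ f ▷ B ≫ μ[B]
    rw [IsMonHom.mul_hom, MonoidalCategory.tensorHom_def', Category.assoc])

variable {f} {M : Mod C A} (a : M ⟶ restrMod f)

/-- The power `a^n : M^{⊗ n} ⟶ B` of an `A`-linear morphism `a : M ⟶ B`. -/
noncomputable def restrPow (n : ℕ) : tpow M n ⟶ restrMod f :=
  powMap (restrMul f) (restrUnit f) a n

lemma modπ_restrPow_succ (n : ℕ) : modπ M (tpow M n) ≫ (restrPow a (n + 1)).hom =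
    M.X ◁ (restrPow a n).hom ≫ a.hom ▷ B ≫ μ[B] := by
  rw [← modπ_restrMul f]
  change modπ M (tpow M n) ≫ (M ◁ restrPow a n ≫ a ▷ restrMod f ≫ restrMul f).hom = _
  rw [Mod.comp_hom', Mod.comp_hom', reassoc_of% @modπ_whiskerLeft, reassoc_of% @modπ_whiskerRight]

variable [Preadditive C] [MonoidalPreadditive C]

/-- If a `B`-linear form `r` with restriction `a` is a split epimorphism, then a morphism `p` to `B`
with `a p = 0` is zero: by linearity `r p = 0`, and `1` is a value of `r`. -/
lemma eq_zero_of_splitEpi {X T Y : C} {t : B ⊗ X ⟶ Y} [Epi (t ▷ T)] {i : B ⟶ Y} {r : Y ⟶ B}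
    (hi : i ≫ r = 𝟙 B) {a : X ⟶ B} (ht : t ≫ r = B ◁ a ≫ μ[B]) {p : T ⟶ B}
    (h : X ◁ p ≫ a ▷ B ≫ μ[B] = 0) : p = 0 := by
  have h1 : (t ≫ r) ▷ T ≫ B ◁ p ≫ μ[B] = 0 := by
    have h2 : (t ≫ r) ▷ T ≫ B ◁ p ≫ μ[B] =
        (α_ B X T).hom ≫ B ◁ (X ◁ p ≫ a ▷ B ≫ μ[B]) ≫ μ[B] := by
      rw [ht, ← whisker_exchange_assoc, comp_whiskerRight_assoc, MonObj.mul_assoc]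
      simp
    rw [h2, h, MonoidalPreadditive.whiskerLeft_zero, zero_comp, comp_zero]
  rw [comp_whiskerRight_assoc, ← comp_zero (f := t ▷ T), cancel_epi] at h1
  have h3 : B ◁ p ≫ μ[B] = 0 := by
    rw [← comp_zero (f := i ▷ T), ← h1, ← comp_whiskerRight_assoc, hi, id_whiskerRight,
      Category.id_comp]
  have h4 : (λ_ T).inv ≫ η[B] ▷ T ≫ B ◁ p ≫ μ[B] = p := by
    rw [← whisker_exchange_assoc, MonObj.one_mul]
    simp
  rw [← h4, h3, comp_zero, comp_zero]

/-- If the restriction `a` of a split epimorphism `B ⊗_A M ⟶ B` satisfies `a^{n+1} = 0`, then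
`a^n = 0`: the values of `a` generate the unit ideal. -/
lemma restrPow_eq_zero_of_succ (s : Retract (regMod B) (extScalars f M)) (n : ℕ)
    (h : restrPow (extRestr s.r) (n + 1) = 0) : restrPow (extRestr s.r) n = 0 := by
  apply Mod.hom_ext
  refine eq_zero_of_splitEpi (t := tπ (restrMod f) M) (i := s.i.hom) (r := s.r.hom)
    (congrArg Mod.Hom.hom s.retract) (tπ_comp_eq s.r) ?_
  rw [← modπ_restrPow_succ, h]
  exact comp_zero

/-- If `Sym^n` vanishes and `B` is a direct summand of `B ⊗_A M`, then `B` is zero. -/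
lemma id_eq_zero_of_symOp_eq_zero (s : Retract (regMod B) (extScalars f M)) {n : ℕ}
    (htf : ∀ {X Y : Mod C A} (g : X ⟶ Y), n.factorial • g = 0 → g = 0) (h : symOp M n = 0) :
    𝟙 B = 0 := by
  have h0 : ∀ n, restrPow (extRestr s.r) n = 0 → f = 0 := by
    intro n
    induction n with
    | zero => exact fun h => congrArg Mod.Hom.hom h
    | succ n ih => exact fun h => ih (restrPow_eq_zero_of_succ s n h)
  have h1 : restrPow (extRestr s.r) n = 0 := htf _ (by
    rw [restrPow, ← symOp_powMap _ _ (restrMul_comm f) (restrMul_assoc f), h, zero_comp])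
  have h2 : η[B] = 0 := by rw [← IsMonHom.one_hom f, h0 n h1, comp_zero]
  have h3 := MonObj.one_mul B
  rw [h2, MonoidalPreadditive.zero_whiskerRight, zero_comp] at h3
  rw [← cancel_epi (λ_ B).hom, ← h3, zero_comp, comp_zero]

end Restriction

/-! ### Non-vanishing of the algebra of words -/

section Nonvanishing

open scoped MonObj

variable {C : Type u} [Category.{v} C] [MonoidalCategory C] [SymmetricCategory C]
  [Preadditive C] [MonoidalPreadditive C]
  [HasCoequalizers C] [∀ X : C, PreservesColimitsOfShape WalkingParallelPair (tensorLeft X)]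
  {A : C} [MonObj A] [IsCommMonObj A] {M N : Mod C A}

/-- Multiplication by `c`, as a sequence of morphisms between mixed tensor powers. -/
noncomputable def mixedSeq (c : 𝟙_ (Mod C A) ⟶ M ⊗ N) : ℕ ⥤ C :=
  Functor.ofSequence (X := fun n => (mixed M N n n).X) fun n => (mulElt c n n).hom

lemma mixedSeq_map_succ (c : 𝟙_ (Mod C A) ⟶ M ⊗ N) (n : ℕ) :
    (mixedSeq c).map (homOfLE (Nat.le_add_right n 1)) = (mulElt c n n).hom :=
  Functor.ofSequence_map_homOfLE_succ _ n

variable [HasColimitsOfShape ℕ C]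

/-- The morphism from `M^{⊗ p} ⊗ N^{⊗ q}` to the colimit of `mixedSeq`: the canonical one in degree
`p - q = 0`, and zero in the other degrees. -/
noncomputable def mixedToColimit (c : 𝟙_ (Mod C A) ⟶ M ⊗ N) (p q : ℕ) :
    (mixed M N p q).X ⟶ colimit (mixedSeq c) :=
  if h : p = q then eqToHom (by subst h; rfl) ≫ colimit.ι (mixedSeq c) q else 0

lemma mixedToColimit_self (c : 𝟙_ (Mod C A) ⟶ M ⊗ N) (p : ℕ) :
    mixedToColimit c p p = colimit.ι (mixedSeq c) p := by
  rw [mixedToColimit, dif_pos rfl]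
  exact Category.id_comp _

lemma mulElt_mixedToColimit (c : 𝟙_ (Mod C A) ⟶ M ⊗ N) (p q : ℕ) :
    (mulElt c p q).hom ≫ mixedToColimit c (p + 1) (q + 1) = mixedToColimit c p q := by
  by_cases h : p = q
  · subst h
    rw [mixedToColimit_self, mixedToColimit_self, ← mixedSeq_map_succ]
    exact colimit.w _ _
  · rw [mixedToColimit, mixedToColimit, dif_neg h, dif_neg (by omega), comp_zero]

/-- If `1 = 0` in the algebra of words, then already in the colimit of the mixed tensor powers of
degree zero. -/
lemma colimit_ι_eq_zero (c : 𝟙_ (Mod C A) ⟶ M ⊗ N)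
    [HasColimitsOfShape (WordCat.{v, max u v, v} c) C] (h : wordUnit c = 0) :
    colimit.ι (mixedSeq c) 0 = 0 := by
  have hy := mulElt_mixedToColimit c
  have h1 := wordι_desc c (wordDesc c (Mod.forget A) (mixedToColimit c) hy)
    (fun i j f hf => map_wordDesc c (Mod.forget A) _ hy hf) .unit
  have h2 : wordι c .unit = 0 := h
  rw [h2, zero_comp] at h1
  replace h1 := h1.trans (wordDesc_unit c (Mod.forget A) (mixedToColimit c) hy)
  rw [mixedToColimit_self] at h1
  have h3 : Epi ((Mod.forget A).map (λ_ (𝟙_ (Mod C A))).inv) := inferInstance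
  exact (cancel_epi ((Mod.forget A).map (λ_ (𝟙_ (Mod C A))).inv)).1 (h1.symm.trans comp_zero.symm)

lemma mixedSeq_map_zero [ExactPairing M N] (n : ℕ) :
    (mixedSeq (η_ M N)).map (homOfLE (Nat.zero_le n)) = (eltPow M N n).hom := by
  induction n with
  | zero => exact (mixedSeq (η_ M N)).map_id 0
  | succ n ih =>
    have h : homOfLE (Nat.zero_le (n + 1)) =
      homOfLE (Nat.zero_le n) ≫ homOfLE (Nat.le_add_right n 1) := rfl
    rw [h, Functor.map_comp, ih, mixedSeq_map_succ]
    rfl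

/-- Linear morphisms out of `A` are determined by their value at `1`. -/
lemma mod_unit_hom_eq_zero {P Q : Mod C A} (e : 𝟙_ (Mod C A) ≅ P) {g : P ⟶ Q}
    (h : η[A] ≫ e.hom.hom ≫ g.hom = 0) : g = 0 := by
  rw [← cancel_epi e.hom, comp_zero]
  apply Mod.hom_ext
  have h1 : μ[A] ≫ (e.hom ≫ g).hom = A ◁ (e.hom ≫ g).hom ≫ lact Q := lact_hom (e.hom ≫ g)
  have h2 := MonObj.mul_one A
  have h3 : (ρ_ A).hom ≫ (e.hom ≫ g).hom = 0 := by
    rw [← h2, Category.assoc, h1, ← MonoidalCategory.whiskerLeft_comp_assoc, Mod.comp_hom', h,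
      MonoidalPreadditive.whiskerLeft_zero, zero_comp]
  exact (cancel_epi (ρ_ A).hom).1 (h3.trans comp_zero.symm)

/-- If the algebra of words on a dual pair is zero, then some power of the coevaluation vanishes,
since the unit object is compact. -/
lemma exists_eltPow_eq_zero [ExactPairing M N]
    [PreservesColimitsOfShape ℕ (coyoneda.obj (op (𝟙_ C)))]
    [HasColimitsOfShape (WordCat.{v, max u v, v} (η_ M N)) C] (h : wordUnit (η_ M N) = 0) :
    ∃ n, eltPow M N n = 0 := by
  let x : 𝟙_ C ⟶ (mixedSeq (η_ M N)).obj 0 := η[A] ≫ (λ_ (𝟙_ (Mod C A))).inv.hom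
  have hc := isColimitOfPreserves (coyoneda.obj (op (𝟙_ C)))
    (colimit.isColimit (mixedSeq (η_ M N)))
  have h1 : x ≫ colimit.ι (mixedSeq (η_ M N)) 0 = 0 ≫ colimit.ι (mixedSeq (η_ M N)) 0 := by
    rw [colimit_ι_eq_zero (η_ M N) h, comp_zero, comp_zero]
  obtain ⟨n, g, hn⟩ := (Types.FilteredColimit.isColimit_eq_iff' hc x
    (0 : 𝟙_ C ⟶ (mixedSeq (η_ M N)).obj 0)).1 h1
  have hn' : x ≫ (mixedSeq (η_ M N)).map g = 0 ≫ (mixedSeq (η_ M N)).map g := hn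
  rw [Subsingleton.elim g (homOfLE (Nat.zero_le n)), mixedSeq_map_zero] at hn'
  exact ⟨n, mod_unit_hom_eq_zero (λ_ (𝟙_ (Mod C A))).symm
    ((Category.assoc _ _ _).symm.trans (hn'.trans zero_comp))⟩

end Nonvanishing

/-! ### Ind-objects -/

section IndCompact

variable (C : Type u) [SmallCategory C] [MonoidalCategory C] [SymmetricCategory C]

variable {C} in
/-- A left Kan extension of a one-element set along the inclusion of the object `x` corepresents
evaluation at `x`. -/
lemma bijective_of_isLeftKanExtension {x : Cᵒᵖ} {U F : Cᵒᵖ ⥤ Type u}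
    {α : Functor.fromPUnit.{0} (𝟙_ (Type u)) ⟶ Functor.fromPUnit.{0} x ⋙ U}
    (_ : U.IsLeftKanExtension α) :
    Function.Bijective fun g : U ⟶ F => g.app x (α.app ⟨⟨⟩⟩ PUnit.unit) := by
  constructor
  · intro g g' h
    refine U.hom_ext_of_isLeftKanExtension α _ _ ?_
    ext ⟨⟨⟩⟩ ⟨⟩
    exact h
  · intro y
    let β : Functor.fromPUnit.{0} (𝟙_ (Type u)) ⟶ Functor.fromPUnit.{0} x ⋙ F :=
      { app := fun _ => TypeCat.ofHom fun _ => y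
        naturality := fun _ _ _ => by
          ext
          simp }
    refine ⟨U.descOfIsLeftKanExtension α F β, ?_⟩
    exact congrArg (fun t => t PUnit.unit) (U.descOfIsLeftKanExtension_fac_app α F β ⟨⟨⟩⟩)

/-- Morphisms from the unit object of `Ind C` to `X` are elements of `X (𝟙_ C)`. -/
lemma exists_unit_corepresents : ∃ e : ((Ind.inclusion C).obj (𝟙_ (Ind C))).obj (op (𝟙_ C)),
    ∀ X : Ind C, Function.Bijective fun f : 𝟙_ (Ind C) ⟶ X =>
      ((Ind.inclusion C).map f).app (op (𝟙_ C)) e := by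
  have hU := (LawfulDayConvolutionMonoidalCategoryStruct.isPointwiseLeftKanExtensionUnitUnit
    Cᵒᵖ (Type u) (Ind C)).isLeftKanExtension
  refine ⟨LawfulDayConvolutionMonoidalCategoryStruct.unitUnit Cᵒᵖ (Type u) (Ind C) PUnit.unit,
    fun X => ?_⟩
  exact (bijective_of_isLeftKanExtension (F := (Ind.inclusion C).obj X) hU).comp
    (Ind.inclusion.fullyFaithful.map_bijective (𝟙_ (Ind C)) X)

/-- The unit object of `Ind C` is compact. -/
lemma preservesColimitsOfShape_coyoneda_unit :
    PreservesColimitsOfShape ℕ (coyoneda.obj (op (𝟙_ (Ind C)))) := by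
  obtain ⟨e, he⟩ := exists_unit_corepresents C
  let α : coyoneda.obj (op (𝟙_ (Ind C))) ⟶
      Ind.inclusion C ⋙ (evaluation _ _).obj (op (𝟙_ C)) :=
    { app := fun X => TypeCat.ofHom fun f => ((Ind.inclusion C).map f).app (op (𝟙_ C)) e
      naturality := fun X Y g => by
        ext f
        simp }
  have (X : Ind C) : IsIso (α.app X) := (isIso_iff_bijective _).2 (he X)
  have : IsIso α := NatIso.isIso_of_isIso_app α
  have : PreservesColimitsOfShape (ULiftHom.{u} (ULift.{u} ℕ)) (Ind.inclusion C) :=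
    inferInstance
  have : PreservesColimitsOfShape ℕ (Ind.inclusion C) :=
    preservesColimitsOfShape_of_equiv (ULiftHomULiftCategory.equiv.{u, u} ℕ).symm _
  exact preservesColimitsOfShape_of_natIso (asIso α).symm

end IndCompact

section IndAdditive

variable (C : Type u) [SmallCategory C] [Abelian C] [MonoidalCategory C] [SymmetricCategory C]
  [∀ X : C, PreservesFiniteColimits (tensorLeft X)]

instance (X : Ind C) : (tensorLeft X).Additive :=
  have : PreservesBinaryBiproducts (tensorLeft X) :=
    preservesBinaryBiproducts_of_preservesBinaryCoproducts _
  Functor.additive_of_preservesBinaryBiproducts _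

instance (X : Ind C) : (tensorRight X).Additive :=
  Functor.additive_of_iso (BraidedCategory.tensorLeftIsoTensorRight X)

instance : MonoidalPreadditive (Ind C) where
  whiskerLeft_zero {X _ _} := (tensorLeft X).map_zero _ _
  zero_whiskerRight {X _ _} := (tensorRight X).map_zero _ _
  whiskerLeft_add {X _ _} _ _ := (tensorLeft X).map_add
  add_whiskerRight {X _ _} _ _ := (tensorRight X).map_add

end IndAdditive

section TorsionFree

/-- Over a field of characteristic zero, `Hom`-groups of ind-objects are torsion free. The action of
the field on `C` suffices for this, as ind-objects are colimits of objects of `C`. -/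
lemma ind_torsionFree (k : Type w) [Field k] [CharZero k] {C : Type u} [SmallCategory C]
    [Abelian C] [Linear k C] {n : ℕ} (hn : n ≠ 0) {X Y : Ind C} (f : X ⟶ Y) (h : n • f = 0) :
    f = 0 := by
  have hadd : (Ind.yoneda (C := C)).Additive := Functor.additive_of_preserves_binary_products _
  -- Maps out of an object of `C`: there, multiplication by `n` is invertible.
  have key (Z : C) (g : Ind.yoneda.obj Z ⟶ Y) (hg : n • g = 0) : g = 0 := by
    have h1 : 𝟙 Z = n • ((n : k)⁻¹ • 𝟙 Z) := by
      rw [← Nat.cast_smul_eq_nsmul k, smul_smul, mul_inv_cancel₀ (Nat.cast_ne_zero.2 hn), one_smul]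
    rw [← Category.id_comp g, ← Ind.yoneda.map_id, h1, Functor.map_nsmul,
      Preadditive.nsmul_comp, ← Preadditive.comp_nsmul, hg, comp_zero]
  -- A section `x` of the presheaf `X` at `Z` is a morphism `t` from the representable object `Z`.
  apply (Ind.inclusion C).map_injective
  apply NatTrans.ext
  funext Z
  ext x
  let t : Ind.yoneda.obj Z.unop ⟶ X := (Ind.inclusion C).preimage
    (Ind.yonedaCompInclusion.hom.app Z.unop ≫ yonedaEquiv.symm x)
  have ht := key _ (t ≫ f) (by rw [← Preadditive.comp_nsmul, h, comp_zero])
  rw [← comp_zero (f := t)] at ht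
  replace ht := congrArg (Ind.inclusion C).map ht
  rw [Functor.map_comp, Functor.map_comp, Functor.map_preimage, Category.assoc, Category.assoc,
    cancel_epi] at ht
  have := congrArg yonedaEquiv ht
  simpa [yonedaEquiv] using this

end TorsionFree

end DeligneTensor

theorem mainTheorem3 (k : Type w) [Field k] [IsAlgClosed k] [CharZero k]
    (𝒜 : Type u) [SmallCategory 𝒜] [Abelian 𝒜] [Linear k 𝒜]
    [MonoidalCategory 𝒜] [SymmetricCategory 𝒜] [MonoidalPreadditive 𝒜] [MonoidalLinear k 𝒜]
    [∀ X : 𝒜, PreservesFiniteLimits (tensorLeft X)]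
    [∀ X : 𝒜, PreservesFiniteColimits (tensorLeft X)]
    [RightRigidCategory 𝒜]
    (hone : Function.Bijective fun c : k => c • 𝟙 (𝟙_ 𝒜))
    (A : CommMon (Ind 𝒜)) (hA : ¬ IsZero A.X)
    (M : Mod (Ind 𝒜) A.X) (hM : Nonempty (HasRightDual M)) :
    (∃ (B : CommMon (Ind 𝒜)) (f : A.X ⟶ B.X) (_ : IsMonHom f), ¬ IsZero B.X ∧
        Nonempty (Retract (DeligneTensor.regMod B.X) (DeligneTensor.extScalars f M))) ↔
      ∀ n : ℕ, ¬ IsZero (DeligneTensor.symPow M n) := by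
  have htf (n : ℕ) {X Y : Mod (Ind 𝒜) A.X} (g : X ⟶ Y) (h : n.factorial • g = 0) : g = 0 :=
    Mod.hom_ext _ _ (DeligneTensor.ind_torsionFree k n.factorial_ne_zero g.hom
      (by rw [← DeligneTensor.mod_nsmul_hom, h]; rfl))
  constructor
  · rintro ⟨B, f, _, hB, ⟨s⟩⟩ n hn
    exact hB ((IsZero.iff_id_eq_zero _).2 (DeligneTensor.id_eq_zero_of_symOp_eq_zero s (htf n)
      ((DeligneTensor.isZero_symPow_iff M n).1 hn)))
  · intro hS
    obtain ⟨_⟩ := hM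
    have : HasColimitsOfSize.{0, 0} (Ind 𝒜) := hasColimitsOfSizeShrink.{0, 0, u, u} _
    have := DeligneTensor.preservesColimitsOfShape_coyoneda_unit 𝒜
    let c : 𝟙_ (Mod (Ind 𝒜) A.X) ⟶ M ⊗ Mᘁ := η_ M Mᘁ
    refine ⟨⟨DeligneTensor.wordAlg c⟩, DeligneTensor.wordUnit c, inferInstance, fun h0 => ?_,
      ⟨DeligneTensor.wordRetract c⟩⟩
    obtain ⟨n, hn⟩ := DeligneTensor.exists_eltPow_eq_zero (M := M) (N := Mᘁ)
      (h0.eq_of_tgt (DeligneTensor.wordUnit c) 0)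
    exact hS n ((DeligneTensor.isZero_symPow_iff M n).2
      (DeligneTensor.symOp_eq_zero (htf n) hn))
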